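/- Let $X_1,X_2,\dots$ be i.i.d. real random variables with density $f$ supported on $\mathcal S\subseteq\mathbb R$ (i.e. $f=0$ off $\mathcal S$), where $f\in C^2(\mathbb R)$ is bounded and bounded away from zero on every compact subset of $\mathrm{int}(\mathcal S)$. For $n\ge 2$ let $X_{(1)}\le\dots\le X_{(n)}$ be the order statistics of $X_1,\dots,X_n$, let $d_i=X_{(i+1)}-X_{(i)}$ $(1\le i\le n-1)$, fix $\alpha\in(0,1)$, let $d_\alpha=\inf\{t:\ \#\{i:d_i\le t\}\ge\alpha(n-1)\}$ be the empirical $\alpha$-quantile of the spacings, and put $h_n=d_\alpha/2$, $q_\alpha=-\log(1-\alpha)$. Then: (i) There are a nondegenerate compact interval $\mathcal J\subset\mathrm{int}(\mathcal S)$ and random variables $\bar f_\alpha=\bar f_{\alpha,n}$ such that $$d_\alpha=\frac{q_\alpha}{n\,\bar f_\alpha}\,\{1+o_p(1)\},\qquad \Pr\Bigl(\inf_{\mathcal J}f\le\bar f_\alpha\le\sup_{\mathcal J}f\Bigr)\to1 .$$ If $\mathcal S$ is an interval, then moreover, with $\mathcal I_\alpha$ the convex hull of $\mathcal J$ and of the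 segment(s) $[X_{(i)},X_{(i+1)}]$ with $d_i=d_\alpha$, one has with probability tending to one $\mathcal I_\alpha\subset\mathrm{int}(\mathcal S)$ and $\inf_{\mathcal I_\alpha}f\le\bar f_\alpha\le\sup_{\mathcal I_\alpha}f$. (ii) $h_n\to0$ in probability, and $h_n$ is exactly of order $1/n$: there are constants $0<c\le C$ with $\Pr(c/n\le h_n\le C/n)\to1$. (iii) The rule undersmooths relative to the rate $n^{-1/5}$: $h_n/n^{-1/5}\to0$ in probability. (iv) SHIDE with $h=h_n$ is pointwise consistent when the bin width satisfies $n\theta_n\to\infty$. Precisely, let $k\ge1$, let $U_{ijl}$ be i.i.d. uniform on $[-1/2,1/2]$ and independent of $(X_i)$, let $m_n\ge1$ be integers and $\theta_n>0$ with $\theta_n\to0$ and $n\theta_n\to\infty$, and form the pseudo-data $X'_{ij}=X_i+\frac{2h_n}{k}\sum_{l=1}^kU_{ijl}$, $i\le n$, $j\le m_n$. Take the density histogram of the $X'_{ij}$ with bins $[o_n+r\theta_n,o_n+(r+1)\theta_n)$, $r\in\mathbb Z$ (with any, possibly random, origin $o_n$), from the bin of the smallest to the bin of the largest $X'_{ij}$;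 let $b_r$ and $p_r$ be the midpoints and heights of its bins, let $S$ be the natural cubic spline through the points $(b_r,\sqrt{p_r})$ (continued linearly outside the range of the midpoints), and let $\widetilde f=S^2$. Then $\widetilde f(x)\to f(x)$ in probability for every $x\in\mathrm{int}(\mathcal S)$. -/

import Mathlib

open MeasureTheory ProbabilityTheory Filter Topology Set

noncomputable section

/-- Standing regularity of a density `f` supported on `S`: it is nonnegative, of class `C²` on the
real line, vanishes off `S`, and is bounded and bounded away from zero on the compact subsets of
the interior of `S`. -/
structure RegularDensity (f : ℝ → ℝ) (S : Set ℝ) : Prop where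
  nonneg : ∀ x, 0 ≤ f x
  contDiff : ContDiff ℝ 2 f
  eq_zero_of_notMem : ∀ x, x ∉ S → f x = 0
  bounds : ∀ K : Set ℝ, IsCompact K → K ⊆ interior S →
    ∃ c C : ℝ, 0 < c ∧ ∀ x ∈ K, c ≤ f x ∧ f x ≤ C

/-- The first `n` observations, as a tuple. -/
def sample {Ω : Type*} (X : ℕ → Ω → ℝ) (n : ℕ) (ω : Ω) : Fin n → ℝ := fun i => X i ω

/-- The order statistics of a tuple (index `i` of `Fin n` is the `(i+1)`-st smallest value). -/
def orderStat {n : ℕ} (x : Fin n → ℝ) (i : Fin n) : ℝ := x (Tuple.sort x i)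

/-- Left end point of the `i`-th consecutive spacing. -/
def spacingLeft {n : ℕ} (x : Fin n → ℝ) (i : Fin (n - 1)) : ℝ :=
  orderStat x ⟨i.1, by omega⟩

/-- Right end point of the `i`-th consecutive spacing. -/
def spacingRight {n : ℕ} (x : Fin n → ℝ) (i : Fin (n - 1)) : ℝ :=
  orderStat x ⟨i.1 + 1, by omega⟩

/-- The `n - 1` consecutive spacings of the order statistics. -/
def spacing {n : ℕ} (x : Fin n → ℝ) (i : Fin (n - 1)) : ℝ :=
  spacingRight x i - spacingLeft x i

/-- The empirical `α`-quantile: the generalised inverse at `α` of the empirical distribution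
function of the values `y`. -/
def empiricalQuantile {m : ℕ} (α : ℝ) (y : Fin m → ℝ) : ℝ :=
  sInf {t : ℝ | α ≤ ((Finset.univ.filter (fun i => y i ≤ t)).card : ℝ) / (m : ℝ)}

/-- `d_α`: the empirical `α`-quantile of the consecutive spacings. -/
def spacingQuantile {n : ℕ} (α : ℝ) (x : Fin n → ℝ) : ℝ :=
  empiricalQuantile α (spacing x)

/-- The raw percentile bandwidth `d_α / 2`. -/
def rawBandwidth {n : ℕ} (α : ℝ) (x : Fin n → ℝ) : ℝ := spacingQuantile α x / 2

/-- The empirical location of the `α`-spacing: the segment between the two neighbouring order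
statistics whose spacing equals `d_α` (the union of these segments if there are ties). -/
def spacingLocation {n : ℕ} (α : ℝ) (x : Fin n → ℝ) : Set ℝ :=
  ⋃ i ∈ {i : Fin (n - 1) | spacing x i = spacingQuantile α x},
    Icc (spacingLeft x i) (spacingRight x i)

/-- The value `v` lies between the infimum and the supremum of `f` on `I`. -/
def BetweenInfSup (f : ℝ → ℝ) (I : Set ℝ) (v : ℝ) : Prop :=
  v ∈ Icc (sInf (f '' I)) (sSup (f '' I))

/-- Pseudo-observations `x i + (2 h / k) (u i j 0 + ⋯ + u i j (k - 1))`, `i < n`, `j < m`. -/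
def pseudoSample {n : ℕ} (m k : ℕ) (h : ℝ) (u : ℕ → ℕ → ℕ → ℝ) (x : Fin n → ℝ) :
    Fin n × Fin m → ℝ :=
  fun p => x p.1 + 2 * h / k * ∑ l ∈ Finset.range k, u p.1 p.2 l

section Histogram

variable {ι : Type*} [Fintype ι]

/-- Index of the bin `[o + r θ, o + (r + 1) θ)` that contains `z`. -/
def binIndex (o θ z : ℝ) : ℤ := ⌊(z - o) / θ⌋

/-- Index of the first occupied bin. -/
def firstBin (o θ : ℝ) (z : ι → ℝ) : ℤ := ⨅ i, binIndex o θ (z i)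

/-- Number of bins from the first to the last occupied one. -/
def numBins (o θ : ℝ) (z : ι → ℝ) : ℕ :=
  ((⨆ i, binIndex o θ (z i)) - firstBin o θ z + 1).toNat

/-- Midpoint of the first bin. -/
def firstMidpoint (o θ : ℝ) (z : ι → ℝ) : ℝ := o + ((firstBin o θ z : ℝ) + 1 / 2) * θ

/-- Height of the density histogram over its bin number `r`, counted from `0`. -/
def binHeight (o θ : ℝ) (z : ι → ℝ) (r : ℕ) : ℝ :=
  ((Finset.univ.filter (fun i => binIndex o θ (z i) = firstBin o θ z + r)).card : ℝ) /
    ((Fintype.card ι : ℝ) * θ)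

end Histogram

/-- The tridiagonal matrix of the natural cubic spline system on `B` equally spaced nodes. -/
def splineMatrix (B : ℕ) : Matrix (Fin B) (Fin B) ℝ := Matrix.of fun i j =>
  if i.1 = 0 ∨ i.1 + 1 = B then (if i = j then 1 else 0)
  else if i = j then 4
  else if i.1 + 1 = j.1 ∨ j.1 + 1 = i.1 then 1 else 0

/-- Right-hand side of the natural cubic spline system for the node values `y`. -/
def splineRhs (θ : ℝ) (B : ℕ) (y : ℕ → ℝ) : Fin B → ℝ := fun i =>
  if i.1 = 0 ∨ i.1 + 1 = B then 0
  else 6 * (y (i.1 + 1) - 2 * y i.1 + y (i.1 - 1)) / θ ^ 2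

/-- The second derivatives of the natural cubic spline at its nodes: the solution of
`M 0 = M (B - 1) = 0`, `M (i - 1) + 4 M i + M (i + 1) = 6 (y (i + 1) - 2 y i + y (i - 1)) / θ²`. -/
def splineMoment (θ : ℝ) (B : ℕ) (y : ℕ → ℝ) (i : ℕ) : ℝ :=
  if hi : i < B then ((splineMatrix B)⁻¹).mulVec (splineRhs θ B y) ⟨i, hi⟩ else 0

/-- The natural cubic spline through `(b + i θ, y i)`, `i < B`, continued linearly outside the
range of its nodes. -/
def naturalSpline (b θ : ℝ) (B : ℕ) (y : ℕ → ℝ) (x : ℝ) : ℝ :=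
  let M := splineMoment θ B y
  let L := B - 1
  if x < b then
    y 0 + ((y 1 - y 0) / θ - θ * M 1 / 6) * (x - b)
  else if b + L * θ < x then
    y L + ((y L - y (L - 1)) / θ + θ * M (L - 1) / 6) * (x - (b + L * θ))
  else
    let i := min ⌊(x - b) / θ⌋₊ (B - 2)
    let s := x - (b + i * θ)
    let t := (b + (i + 1) * θ) - x
    M (i + 1) * s ^ 3 / (6 * θ) + M i * t ^ 3 / (6 * θ)
      + (y (i + 1) / θ - M (i + 1) * θ / 6) * s + (y i / θ - M i * θ / 6) * t

/-- The SHIDE density estimate at `x` computed from the pseudo-sample `z`: the square of the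
natural cubic spline through the square roots of the histogram heights at the bin midpoints. -/
def shide {ι : Type*} [Fintype ι] (o θ : ℝ) (z : ι → ℝ) (x : ℝ) : ℝ :=
  naturalSpline (firstMidpoint o θ z) θ (numBins o θ z) (fun r => √(binHeight o θ z r)) x ^ 2

/-- The spline system is nonsingular, so that the inverse in `splineMoment` is the true one. -/
theorem splineMatrix_det_ne_zero (B : ℕ) : (splineMatrix B).det ≠ 0 := by
  apply det_ne_zero_of_sum_row_lt_diag
  intro i
  by_cases hi : i.1 = 0 ∨ i.1 + 1 = B
  · have h0 : ∑ j ∈ Finset.univ.erase i, ‖splineMatrix B i j‖ = 0 := by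
      apply Finset.sum_eq_zero
      intro j hj
      have hne : i ≠ j := fun e => (Finset.ne_of_mem_erase hj) e.symm
      simp [splineMatrix, hi, hne]
    rw [h0]
    simp [splineMatrix, hi]
  · have hB := i.2
    have hsub : ∑ j ∈ Finset.univ.erase i, ‖splineMatrix B i j‖ ≤
        ∑ j ∈ ({⟨i.1 - 1, by omega⟩, ⟨i.1 + 1, by omega⟩} : Finset (Fin B)), (1 : ℝ) := by
      rw [← Finset.sum_filter_add_sum_filter_not _ (fun j : Fin B => i.1 + 1 = j.1 ∨ j.1 + 1 = i.1)]
      have hz : ∑ j ∈ (Finset.univ.erase i).filter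
          (fun j : Fin B => ¬ (i.1 + 1 = j.1 ∨ j.1 + 1 = i.1)), ‖splineMatrix B i j‖ = 0 := by
        apply Finset.sum_eq_zero
        intro j hj
        rw [Finset.mem_filter] at hj
        have hne : i ≠ j := fun e => (Finset.ne_of_mem_erase hj.1) e.symm
        simp [splineMatrix, hi, hne, hj.2]
      rw [hz, add_zero]
      calc _ ≤ ∑ j ∈ (Finset.univ.erase i).filter
            (fun j : Fin B => i.1 + 1 = j.1 ∨ j.1 + 1 = i.1), (1 : ℝ) := by
            apply Finset.sum_le_sum
            intro j hj
            rw [Finset.mem_filter] at hj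
            have hne : i ≠ j := fun e => (Finset.ne_of_mem_erase hj.1) e.symm
            simp [splineMatrix, hi, hne, hj.2]
        _ ≤ _ := by
            apply Finset.sum_le_sum_of_subset_of_nonneg
            · intro j hj
              rw [Finset.mem_filter] at hj
              simp only [Finset.mem_insert, Finset.mem_singleton, Fin.ext_iff]
              omega
            · intros; norm_num
    have hd : ‖splineMatrix B i i‖ = 4 := by simp [splineMatrix, hi]
    rw [hd]
    refine lt_of_le_of_lt hsub ?_
    rw [Finset.sum_const, nsmul_eq_mul, mul_one]
    have := Finset.card_le_two (a := (⟨i.1 - 1, by omega⟩ : Fin B)) (b := ⟨i.1 + 1, by omega⟩)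
    exact lt_of_le_of_lt (by exact_mod_cast this) (by norm_num : (2 : ℝ) < 4)

end

/-! The quantile statements all follow from `n * d_α → τ` in probability, where `G t = ∫ exp (-t f)
f` (`spacingSurvival`) and `G τ = 1 - α`. Locally the sample looks like a Poisson process of
intensity `n f`, so a spacing near `x`, multiplied by `n`, is roughly exponential with rate `f x`,
and `1 - G` is the resulting mixture. Sorting is avoided by counting. Without ties, the observations
with no neighbour within `s` to their right are the left end points of the spacings exceeding `s`,
together with the maximum. For `s = t / n`, conditioning on one observation gives isolation
probability tending to `G t`. Conditioning on two gives a bound tending to `G t ^ 2`, since the two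
short windows are eventually disjoint. Chebyshev's inequality then gives a weak law
(`tendsto_measureReal_isolatedCount`), and strict monotonicity of `G` carries it over to the
quantile (`withHighProbability_abs_mul_spacingQuantile_sub`). For the expansion, `f̄` is the
constant `q_α / τ`. Since `exp (-τ f̄) = 1 - α` is the mean of `exp (-τ f)`, continuity makes `f̄` a
value `f x`. Positivity of this value puts `x` in the interior of `S`, and a small closed ball
around `x` serves as `J`. For consistency, a pseudo-observation is within `h_n = O(1 / n) = o(θ_n)`
of its observation, so a bin count lies between counts of original observations in slightly smaller
and larger windows. These are uniformly accurate over any fixed number of bins around the point, as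
`n θ_n → ∞`. The spline is global, but by strict diagonal dominance the influence of a node decays
at least like `(2 / 3) ^ d` with its distance `d` in bins (`dampingWeight_mul_splineMoment_le`). Far
root heights grow at most linearly in `d`, with a factor bounded in probability (`cauchyAverage`),
so their contribution is negligible. -/

/-- The measure on the real line with density `f`. -/
noncomputable abbrev densityMeasure (f : ℝ → ℝ) : Measure ℝ :=
  volume.withDensity fun x => ENNReal.ofReal (f x)

/-! ### Positivity set of the density and local mass of short intervals -/

theorem RegularDensity.pos_iff {f : ℝ → ℝ} {S : Set ℝ} (hf : RegularDensity f S) (x : ℝ) :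
    0 < f x ↔ x ∈ interior S := by
  constructor
  · intro hx
    have hopen : IsOpen {y | 0 < f y} := isOpen_lt continuous_const hf.contDiff.continuous
    refine interior_maximal (fun y hy => ?_) hopen hx
    by_contra h
    exact (ne_of_gt hy) (hf.eq_zero_of_notMem y h)
  · intro hx
    obtain ⟨c, C, hc, h⟩ := hf.bounds {x} isCompact_singleton (by simpa using hx)
    exact hc.trans_le (h x rfl).1

theorem densityMeasure_real_Ioc {f : ℝ → ℝ} (hc : Continuous f) (h0 : ∀ x, 0 ≤ f x)
    {a b : ℝ} (hab : a ≤ b) : (densityMeasure f).real (Ioc a b) = ∫ x in a..b, f x := by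
  rw [measureReal_def, withDensity_apply _ measurableSet_Ioc,
    intervalIntegral.integral_of_le hab,
    integral_eq_lintegral_of_nonneg_ae (ae_of_all _ h0) hc.aestronglyMeasurable]

theorem abs_densityMeasure_real_Ioc_sub_le {f : ℝ → ℝ} (hc : Continuous f) (h0 : ∀ x, 0 ≤ f x)
    {a b c ε : ℝ} (hab : a ≤ b) (h : ∀ y ∈ Icc a b, |f y - c| ≤ ε) :
    |(densityMeasure f).real (Ioc a b) - c * (b - a)| ≤ ε * (b - a) := by
  rw [densityMeasure_real_Ioc hc h0 hab]
  have h1 : (∫ x in a..b, f x) - c * (b - a) = ∫ x in a..b, (f x - c) := by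
    rw [intervalIntegral.integral_sub (hc.intervalIntegrable _ _) intervalIntegrable_const,
      intervalIntegral.integral_const, smul_eq_mul, mul_comm c]
  rw [h1]
  have := intervalIntegral.norm_integral_le_of_norm_le_const (a := a) (b := b) (C := ε)
    (f := fun x => f x - c) (fun y hy => by
      rw [uIoc_of_le hab] at hy
      exact h y ⟨hy.1.le, hy.2⟩)
  rwa [Real.norm_eq_abs, abs_of_nonneg (sub_nonneg.2 hab)] at this

/-- By continuity, `f` is within `ε / 2` of `f x` on a neighbourhood that eventually contains the
interval. Both end points may move, as needed for windows placed at a multiple of the bin width from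
`x`. -/
theorem tendsto_densityMeasure_real_Ioc_div {ι : Type*} {l : Filter ι} {f : ℝ → ℝ}
    (hc : Continuous f) (h0 : ∀ x, 0 ≤ f x) {x : ℝ} {u v : ι → ℝ} (huv : ∀ᶠ i in l, u i < v i)
    (hu : Tendsto u l (𝓝 x)) (hv : Tendsto v l (𝓝 x)) :
    Tendsto (fun i => (densityMeasure f).real (Ioc (u i) (v i)) / (v i - u i)) l (𝓝 (f x)) := by
  rw [Metric.tendsto_nhds]
  intro ε hε
  obtain ⟨δ, hδ, h⟩ := Metric.continuousAt_iff.1 hc.continuousAt (ε / 2) (half_pos hε)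
  filter_upwards [huv, Metric.tendsto_nhds.1 hu δ hδ, Metric.tendsto_nhds.1 hv δ hδ]
    with i hi hui hvi
  have hpos : 0 < v i - u i := sub_pos.2 hi
  have key := abs_densityMeasure_real_Ioc_sub_le hc h0 hi.le (c := f x) (ε := ε / 2) (by
    intro y hy
    have hy' : dist y x < δ := by
      rw [Real.dist_eq, abs_lt] at *
      constructor <;> linarith [hy.1, hy.2, hui.1, hvi.2]
    exact (h hy').le)
  rw [Real.dist_eq]
  have : (densityMeasure f).real (Ioc (u i) (v i)) / (v i - u i) - f x =
      ((densityMeasure f).real (Ioc (u i) (v i)) - f x * (v i - u i)) / (v i - u i) := by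
    field_simp
  rw [this, abs_div, abs_of_pos hpos, div_lt_iff₀ hpos]
  nlinarith

theorem ae_densityMeasure_pos {f : ℝ → ℝ} (hc : Continuous f) :
    ∀ᵐ x ∂densityMeasure f, 0 < f x := by
  rw [ae_withDensity_iff (by fun_prop)]
  exact ae_of_all _ fun x hx => by
    by_contra h
    exact hx (ENNReal.ofReal_of_nonpos (not_lt.1 h))

/-! ### The limiting survival function of the rescaled spacings -/

/-- The limit of the probability that a rescaled spacing exceeds `t`. -/
noncomputable def spacingSurvival (f : ℝ → ℝ) (t : ℝ) : ℝ :=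
  ∫ x, Real.exp (-(t * f x)) ∂densityMeasure f

section Survival

variable {f : ℝ → ℝ}

theorem exp_neg_mul_le_one (h0 : ∀ x, 0 ≤ f x) {t : ℝ} (ht : 0 ≤ t) (x : ℝ) :
    ‖Real.exp (-(t * f x))‖ ≤ 1 := by
  rw [Real.norm_eq_abs, Real.abs_exp, Real.exp_le_one_iff, neg_nonpos]
  exact mul_nonneg ht (h0 x)

theorem integrable_exp_neg_mul [IsFiniteMeasure (densityMeasure f)] (hc : Continuous f)
    (h0 : ∀ x, 0 ≤ f x) {t : ℝ} (ht : 0 ≤ t) :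
    Integrable (fun x => Real.exp (-(t * f x))) (densityMeasure f) :=
  (integrable_const (1 : ℝ)).mono' (by fun_prop) (ae_of_all _ (exp_neg_mul_le_one h0 ht))

theorem spacingSurvival_zero [IsProbabilityMeasure (densityMeasure f)] :
    spacingSurvival f 0 = 1 := by
  simp [spacingSurvival]

theorem continuousOn_spacingSurvival [IsFiniteMeasure (densityMeasure f)] (hc : Continuous f)
    (h0 : ∀ x, 0 ≤ f x) : ContinuousOn (spacingSurvival f) (Ici 0) := by
  refine continuousOn_of_dominated (bound := fun _ => 1) ?_ ?_ (integrable_const 1) ?_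
  · intro t _
    fun_prop
  · intro t ht
    exact ae_of_all _ (exp_neg_mul_le_one h0 ht)
  · exact ae_of_all _ fun x => by fun_prop

theorem tendsto_spacingSurvival_atTop [IsFiniteMeasure (densityMeasure f)] (hc : Continuous f)
    (h0 : ∀ x, 0 ≤ f x) : Tendsto (fun n : ℕ => spacingSurvival f n) atTop (𝓝 0) := by
  have := tendsto_integral_of_dominated_convergence (μ := densityMeasure f)
    (F := fun (n : ℕ) x => Real.exp (-(n * f x))) (f := fun _ => 0) (fun _ => 1)
    (fun n => by fun_prop) (integrable_const 1)
    (fun n => ae_of_all _ (exp_neg_mul_le_one h0 n.cast_nonneg))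
    (by
      filter_upwards [ae_densityMeasure_pos hc] with x hx
      exact Real.tendsto_exp_neg_atTop_nhds_zero.comp
        (tendsto_natCast_atTop_atTop.atTop_mul_const hx))
  rw [integral_zero] at this
  exact this

/-- The density is positive almost everywhere for its own measure, so the integrands are strictly
ordered almost everywhere. Equal integrals would force them to agree almost everywhere. -/
theorem spacingSurvival_strictAntiOn [IsProbabilityMeasure (densityMeasure f)]
    (hc : Continuous f) (h0 : ∀ x, 0 ≤ f x) : StrictAntiOn (spacingSurvival f) (Ici 0) := by
  intro s hs t ht hst
  have hlt : ∀ᵐ x ∂densityMeasure f, Real.exp (-(t * f x)) < Real.exp (-(s * f x)) := by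
    filter_upwards [ae_densityMeasure_pos hc] with x hx
    exact Real.exp_lt_exp.2 (neg_lt_neg (mul_lt_mul_of_pos_right hst hx))
  refine lt_of_le_of_ne (integral_mono_ae (integrable_exp_neg_mul hc h0 ht)
    (integrable_exp_neg_mul hc h0 hs) (hlt.mono fun x hx => hx.le)) fun heq => ?_
  have h := (integral_eq_iff_of_ae_le (integrable_exp_neg_mul hc h0 ht)
    (integrable_exp_neg_mul hc h0 hs) (hlt.mono fun x hx => hx.le)).1 heq
  have : ∀ᵐ x ∂densityMeasure f, False := by
    filter_upwards [hlt, h] with x h1 h2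
    exact absurd h2 h1.ne
  obtain ⟨x, hx⟩ := this.exists
  exact hx

theorem exists_spacingSurvival_eq [IsProbabilityMeasure (densityMeasure f)]
    (hc : Continuous f) (h0 : ∀ x, 0 ≤ f x) {p : ℝ} (hp : p ∈ Ioo (0 : ℝ) 1) :
    ∃ τ, 0 < τ ∧ spacingSurvival f τ = p := by
  obtain ⟨n, hn⟩ := ((tendsto_spacingSurvival_atTop hc h0).eventually (gt_mem_nhds hp.1)).exists
  have h1 := intermediate_value_Icc' (f := spacingSurvival f) (n.cast_nonneg (α := ℝ))
    ((continuousOn_spacingSurvival hc h0).mono Icc_subset_Ici_self)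
  obtain ⟨τ, hτ, h⟩ := h1 ⟨hn.le, by rw [spacingSurvival_zero]; exact hp.2.le⟩
  refine ⟨τ, lt_of_le_of_ne hτ.1 fun h0 => ?_, h⟩
  rw [← h0, spacingSurvival_zero] at h
  exact hp.2.ne h.symm

/-- The level at which `exp (- τ f)` attains its mean is a value of the density. -/
theorem exists_eq_of_exp_eq_spacingSurvival [IsProbabilityMeasure (densityMeasure f)]
    (hc : Continuous f) (h0 : ∀ x, 0 ≤ f x) {τ v : ℝ} (hτ : 0 < τ)
    (h : spacingSurvival f τ = Real.exp (-(τ * v))) : ∃ x, f x = v := by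
  by_contra hne
  push Not at hne
  have hconst : (∫ _, Real.exp (-(τ * v)) ∂densityMeasure f) = Real.exp (-(τ * v)) := by simp
  have hint := integrable_exp_neg_mul hc h0 hτ.le
  -- A continuous function on the line that misses `v` stays on one side of it. Then `exp (-τ f)` is
  -- strictly on one side of its own mean, which is impossible.
  have hside : (∀ x, f x < v) ∨ ∀ x, v < f x := by
    by_contra hcon
    push Not at hcon
    obtain ⟨⟨a, ha⟩, b, hb⟩ := hcon
    obtain ⟨x, hx⟩ := mem_range_of_exists_le_of_exists_ge hc ⟨b, hb⟩ ⟨a, ha⟩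
    exact hne x hx
  have hcontra : ∀ g₁ g₂ : ℝ → ℝ, Integrable g₁ (densityMeasure f) →
      Integrable g₂ (densityMeasure f) → (∀ x, g₁ x < g₂ x) →
      (∫ x, g₁ x ∂densityMeasure f) = ∫ x, g₂ x ∂densityMeasure f → False := by
    intro g₁ g₂ i₁ i₂ hlt he
    obtain ⟨x, hx⟩ := ((integral_eq_iff_of_ae_le i₁ i₂
      (ae_of_all _ fun x => (hlt x).le)).1 he).exists
    exact (hlt x).ne hx
  rcases hside with hs | hs
  · exact hcontra _ _ (integrable_const (Real.exp (-(τ * v)))) hint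
      (fun x => Real.exp_lt_exp.2 (neg_lt_neg (mul_lt_mul_of_pos_left (hs x) hτ)))
      (hconst.trans h.symm)
  · exact hcontra _ _ hint (integrable_const (Real.exp (-(τ * v))))
      (fun x => Real.exp_lt_exp.2 (neg_lt_neg (mul_lt_mul_of_pos_left (hs x) hτ)))
      (h.trans hconst.symm)

end Survival

/-! ### Isolation probabilities by conditioning on one or two observations -/

section Independence

variable {Ω : Type*} [MeasurableSpace Ω] {P : Measure Ω} [IsProbabilityMeasure P]
  {X : ℕ → Ω → ℝ} {μ : Measure ℝ}

theorem map_pair_eq_prod (hXm : ∀ i, Measurable (X i)) (hX : iIndepFun X P)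
    (hlaw : ∀ i, P.map (X i) = μ) {i j : ℕ} (hij : i ≠ j) :
    P.map (fun ω => (X i ω, X j ω)) = μ.prod μ := by
  rw [(indepFun_iff_map_prod_eq_prod_map_map (hXm i).aemeasurable (hXm j).aemeasurable).1
    (hX.indepFun hij), hlaw, hlaw]

variable [IsProbabilityMeasure μ]

/-- The probability that none of finitely many i.i.d. variables falls into a region determined by
an independent variable. -/
theorem measure_forall_notMem_eq_lintegral (hXm : ∀ i, Measurable (X i)) (hX : iIndepFun X P)
    (hlaw : ∀ i, P.map (X i) = μ) {β : Type*} [MeasurableSpace β] {Z : Ω → β} (hZ : Measurable Z)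
    (T : Finset ℕ) (hind : IndepFun Z (fun ω (l : T) => X l ω) P)
    {D : Set (β × ℝ)} (hD : MeasurableSet D) :
    P {ω | ∀ l ∈ T, (Z ω, X l ω) ∉ D} =
      ∫⁻ z, μ {w | (z, w) ∉ D} ^ T.card ∂(P.map Z) := by
  have hY : Measurable (fun ω (l : T) => X l ω) := measurable_pi_lambda _ fun l => hXm l
  have hmapY : P.map (fun ω (l : T) => X l ω) = Measure.pi fun _ => μ := by
    have h1 : iIndepFun (fun (l : T) ω => X l ω) P := hX.precomp Subtype.val_injective
    rw [(iIndepFun_iff_map_fun_eq_pi_map fun l : T => (hXm l).aemeasurable).1 h1]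
    simp [hlaw]
  have hjoint := (indepFun_iff_map_prod_eq_prod_map_map hZ.aemeasurable hY.aemeasurable).1 hind
  rw [hmapY] at hjoint
  have hE : MeasurableSet {q : β × (T → ℝ) | ∀ l, (q.1, q.2 l) ∉ D} := by
    have : {q : β × (T → ℝ) | ∀ l, (q.1, q.2 l) ∉ D} =
        ⋂ l : T, (fun q : β × (T → ℝ) => (q.1, q.2 l)) ⁻¹' Dᶜ := by
      ext q; simp
    rw [this]
    exact MeasurableSet.iInter fun l => hD.compl.preimage
      (measurable_fst.prodMk ((measurable_pi_apply l).comp measurable_snd))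
  have hset : {ω | ∀ l ∈ T, (Z ω, X l ω) ∉ D} =
      (fun ω => (Z ω, fun l : T => X l ω)) ⁻¹' {q | ∀ l, (q.1, q.2 l) ∉ D} := by
    ext ω; simp
  have : IsProbabilityMeasure (P.map Z) := Measure.isProbabilityMeasure_map hZ.aemeasurable
  rw [hset, ← Measure.map_apply (hZ.prodMk hY) hE, hjoint, Measure.prod_apply hE]
  refine lintegral_congr fun z => ?_
  have : Prod.mk z ⁻¹' {q : β × (T → ℝ) | ∀ l, (q.1, q.2 l) ∉ D} =
      univ.pi fun _ => {w | (z, w) ∉ D} := by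
    ext q; simp
  rw [this, Measure.pi_pi]
  simp

theorem measureReal_forall_notMem_eq_integral (hXm : ∀ i, Measurable (X i)) (hX : iIndepFun X P)
    (hlaw : ∀ i, P.map (X i) = μ) {β : Type*} [MeasurableSpace β] {Z : Ω → β} (hZ : Measurable Z)
    (T : Finset ℕ) (hind : IndepFun Z (fun ω (l : T) => X l ω) P)
    {D : Set (β × ℝ)} (hD : MeasurableSet D) :
    P.real {ω | ∀ l ∈ T, (Z ω, X l ω) ∉ D} =
      ∫ z, (1 - μ.real {w | (z, w) ∈ D}) ^ T.card ∂(P.map Z) := by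
  have hsec : ∀ z, MeasurableSet {w | (z, w) ∈ D} := fun z => measurable_prodMk_left hD
  have hmeas : Measurable fun z => μ {w | (z, w) ∈ D} := measurable_measure_prodMk_left hD
  rw [measureReal_def, measure_forall_notMem_eq_lintegral hXm hX hlaw hZ T hind hD,
    integral_eq_lintegral_of_nonneg_ae]
  · congr 1
    refine lintegral_congr fun z => ?_
    have h1 : {w | (z, w) ∉ D} = {w | (z, w) ∈ D}ᶜ := rfl
    have h2 : 1 - μ.real {w | (z, w) ∈ D} = μ.real {w | (z, w) ∈ D}ᶜ :=
      (probReal_compl_eq_one_sub (hsec z)).symm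
    rw [h1, h2, ENNReal.ofReal_pow measureReal_nonneg, ofReal_measureReal]
  · exact ae_of_all _ fun z => pow_nonneg (sub_nonneg.2 measureReal_le_one) _
  · exact ((measurable_const.sub hmeas.ennreal_toReal).pow_const _).aestronglyMeasurable

theorem prod_diagonal_eq_zero (μ : Measure ℝ) [SFinite μ] [NullSingletonClass μ] :
    (μ.prod μ) {z | z.1 = z.2} = 0 := by
  rw [Measure.prod_apply (measurableSet_eq_fun measurable_fst measurable_snd)]
  have : ∀ x : ℝ, Prod.mk x ⁻¹' {z : ℝ × ℝ | z.1 = z.2} = {x} := by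
    intro x; ext y; simp [eq_comm]
  simp [this]

/-- The law has no atoms, so the diagonal is null for each pair, and there are countably many pairs.
-/
theorem ae_injective [NullSingletonClass μ] (hXm : ∀ i, Measurable (X i)) (hX : iIndepFun X P)
    (hlaw : ∀ i, P.map (X i) = μ) : ∀ᵐ ω ∂P, Function.Injective fun i => X i ω := by
  have : ∀ i j : ℕ, i ≠ j → ∀ᵐ ω ∂P, X i ω ≠ X j ω := by
    intro i j hij
    have h := prod_diagonal_eq_zero μ
    rw [← map_pair_eq_prod hXm hX hlaw hij, Measure.map_apply ((hXm i).prodMk (hXm j))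
      (measurableSet_eq_fun measurable_fst measurable_snd)] at h
    rw [ae_iff]
    convert h using 2
    ext ω
    simp
  have h2 : ∀ᵐ ω ∂P, ∀ i j : ℕ, i ≠ j → X i ω ≠ X j ω :=
    ae_all_iff.2 fun i => ae_all_iff.2 fun j => eventually_imp_distrib_left.2 (this i j)
  filter_upwards [h2] with ω hω i j h
  by_contra hij
  exact hω i j hij h

/-- No observation among the first `n` lies within distance `s` to the right of the `i`-th one. -/
def rightIsolated (X : ℕ → Ω → ℝ) (n : ℕ) (s : ℝ) (i : ℕ) : Set Ω :=
  {ω | ∀ j ∈ Finset.range n, X j ω ∉ Ioc (X i ω) (X i ω + s)}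

theorem measurableSet_rightIsolated (hXm : ∀ i, Measurable (X i)) (n : ℕ) (s : ℝ) (i : ℕ) :
    MeasurableSet (rightIsolated X n s i) := by
  have : rightIsolated X n s i = ⋂ j ∈ Finset.range n,
      ({ω | X i ω < X j ω} ∩ {ω | X j ω ≤ X i ω + s})ᶜ := by
    ext ω; simp [rightIsolated, Ioc]
  rw [this]
  exact Finset.measurableSet_biInter _ fun j _ =>
    ((measurableSet_lt (hXm i) (hXm j)).inter
      (measurableSet_le (hXm j) ((hXm i).add_const s))).compl

theorem measurableSet_setOf_mem_Ioc {β : Type*} [MeasurableSpace β] {g : β → ℝ}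
    (hg : Measurable g) (s : ℝ) : MeasurableSet {q : β × ℝ | q.2 ∈ Ioc (g q.1) (g q.1 + s)} :=
  (measurableSet_lt (hg.comp measurable_fst) measurable_snd).inter
    (measurableSet_le measurable_snd ((hg.comp measurable_fst).add_const s))

theorem measureReal_rightIsolated (hXm : ∀ i, Measurable (X i)) (hX : iIndepFun X P)
    (hlaw : ∀ i, P.map (X i) = μ) {n i : ℕ} (hi : i < n) (s : ℝ) :
    P.real (rightIsolated X n s i) = ∫ x, (1 - μ.real (Ioc x (x + s))) ^ (n - 1) ∂μ := by
  have hset : rightIsolated X n s i =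
      {ω | ∀ l ∈ (Finset.range n).erase i, (X i ω, X l ω) ∉
        {q : ℝ × ℝ | q.2 ∈ Ioc q.1 (q.1 + s)}} := by
    ext ω
    refine ⟨fun h l hl => h l (Finset.mem_of_mem_erase hl), fun h l hl => ?_⟩
    -- The window is open on the left, so an observation never lies in its own window and its index
    -- can be dropped.
    by_cases hli : l = i
    · subst hli
      exact fun hmem => lt_irrefl _ hmem.1
    · exact h l (Finset.mem_erase.2 ⟨hli, hl⟩)
  have hind : IndepFun (X i) (fun ω (l : (Finset.range n).erase i) => X l ω) P := by
    have := hX.indepFun_finset {i} ((Finset.range n).erase i) (by simp) hXm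
    exact this.comp (φ := fun v : ({i} : Finset ℕ) → ℝ => v ⟨i, by simp⟩) (ψ := id) (by fun_prop) measurable_id
  rw [hset, measureReal_forall_notMem_eq_integral hXm hX hlaw (hXm i) _ hind
    (by exact measurableSet_setOf_mem_Ioc measurable_id s), hlaw,
    Finset.card_erase_of_mem (Finset.mem_range.2 hi), Finset.card_range]
  rfl

/-- Given the two observations, each of the other `n - 2` must avoid both windows. The requirement
that the two also avoid each other's windows is discarded, hence only an inequality; an upper bound
suffices for the variance. -/
theorem measureReal_rightIsolated_inter_le (hXm : ∀ i, Measurable (X i)) (hX : iIndepFun X P)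
    (hlaw : ∀ i, P.map (X i) = μ) {n i j : ℕ} (hi : i < n) (hj : j < n) (hij : i ≠ j) (s : ℝ) :
    P.real (rightIsolated X n s i ∩ rightIsolated X n s j) ≤
      ∫ z, (1 - μ.real (Ioc z.1 (z.1 + s) ∪ Ioc z.2 (z.2 + s))) ^ (n - 2) ∂(μ.prod μ) := by
  set T := ((Finset.range n).erase i).erase j with hT
  have hsub : rightIsolated X n s i ∩ rightIsolated X n s j ⊆
      {ω | ∀ l ∈ T, ((X i ω, X j ω), X l ω) ∉
        {q : (ℝ × ℝ) × ℝ | q.2 ∈ Ioc q.1.1 (q.1.1 + s)} ∪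
          {q : (ℝ × ℝ) × ℝ | q.2 ∈ Ioc q.1.2 (q.1.2 + s)}} := by
    rintro ω ⟨h1, h2⟩ l hl
    have hl' : l ∈ Finset.range n := Finset.mem_of_mem_erase (Finset.mem_of_mem_erase hl)
    rintro (h | h)
    exacts [h1 l hl' h, h2 l hl' h]
  have hind : IndepFun (fun ω => (X i ω, X j ω)) (fun ω (l : T) => X l ω) P := by
    have := hX.indepFun_finset {i, j} T (by simp [hT]) hXm
    exact this.comp (φ := fun v : ({i, j} : Finset ℕ) → ℝ => (v ⟨i, by simp⟩, v ⟨j, by simp⟩)) (ψ := id)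
      (by fun_prop) measurable_id
  refine (measureReal_mono hsub).trans_eq ?_
  rw [measureReal_forall_notMem_eq_integral hXm hX hlaw ((hXm i).prodMk (hXm j)) T hind
    ((measurableSet_setOf_mem_Ioc measurable_fst s).union
      (measurableSet_setOf_mem_Ioc measurable_snd s)), map_pair_eq_prod hXm hX hlaw hij,
    hT, Finset.card_erase_of_mem (Finset.mem_erase.2 ⟨hij.symm, Finset.mem_range.2 hj⟩),
    Finset.card_erase_of_mem (Finset.mem_range.2 hi), Finset.card_range]
  rfl

end Independence

/-- The Poisson limit. The shift `k` is the number of observations conditioned on, one or two; it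
costs the factor `(1 - p n) ^ k → 1`. -/
theorem tendsto_one_sub_pow_sub {p : ℕ → ℝ} {r : ℝ} (h : Tendsto (fun n : ℕ => n * p n) atTop (𝓝 r))
    (k : ℕ) : Tendsto (fun n => (1 - p n) ^ (n - k)) atTop (𝓝 (Real.exp (-r))) := by
  have hp : Tendsto p atTop (𝓝 0) := by
    have := h.mul (tendsto_inv_atTop_zero.comp (tendsto_natCast_atTop_atTop (R := ℝ)))
    rw [mul_zero] at this
    refine this.congr' ?_
    filter_upwards [eventually_ne_atTop 0] with n hn
    have : (n : ℝ) ≠ 0 := Nat.cast_ne_zero.2 hn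
    simp only [Function.comp]
    field_simp
  have h1 : Tendsto (fun n => 1 - p n) atTop (𝓝 1) := by simpa using hp.const_sub 1
  have h2 : Tendsto (fun n => (1 - p n) ^ n) atTop (𝓝 (Real.exp (-r))) := by
    have := Real.tendsto_one_add_pow_exp_of_tendsto (g := fun n => -p n) (t := -r)
      (by simpa using h.neg)
    simpa [sub_eq_add_neg] using this
  have h3 := h2.div (h1.pow k) (by simp)
  simp only [one_pow, div_one] at h3
  refine h3.congr' ?_
  filter_upwards [h1.eventually_ne one_ne_zero, eventually_ge_atTop k] with n hn hk
  simp only [Pi.div_apply]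
  rw [div_eq_iff (pow_ne_zero _ hn), ← pow_add, Nat.sub_add_cancel hk]

/-! ### Weak law for the number of isolated observations -/

section Spacings

variable {f : ℝ → ℝ}

theorem tendsto_mul_densityMeasure_Ioc (hc : Continuous f) (h0 : ∀ x, 0 ≤ f x) {t : ℝ}
    (ht : 0 < t) (x : ℝ) :
    Tendsto (fun n : ℕ => n * (densityMeasure f).real (Ioc x (x + t / n))) atTop (𝓝 (t * f x)) := by
  have hv : Tendsto (fun n : ℕ => x + t / n) atTop (𝓝 x) := by
    simpa using (tendsto_const_div_atTop_nhds_zero_nat t).const_add x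
  have := (tendsto_densityMeasure_real_Ioc_div (l := atTop) hc h0 (u := fun _ => x) (by
    filter_upwards [eventually_gt_atTop 0] with n hn
    have : (0 : ℝ) < n := Nat.cast_pos.2 hn
    linarith [div_pos ht this]) tendsto_const_nhds hv).const_mul t
  refine this.congr' ?_
  filter_upwards [eventually_gt_atTop 0] with n hn
  have : (0 : ℝ) < n := Nat.cast_pos.2 hn
  rw [add_sub_cancel_left]
  field_simp

variable [IsProbabilityMeasure (densityMeasure f)]

theorem tendsto_integral_one_sub_pow (hc : Continuous f) (h0 : ∀ x, 0 ≤ f x) {t : ℝ}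
    (ht : 0 < t) :
    Tendsto (fun n : ℕ => ∫ x, (1 - (densityMeasure f).real (Ioc x (x + t / n))) ^ (n - 1)
      ∂densityMeasure f) atTop (𝓝 (spacingSurvival f t)) := by
  refine tendsto_integral_of_dominated_convergence (fun _ => 1) (fun n => ?_)
    (integrable_const 1) (fun n => ae_of_all _ fun x => ?_) (ae_of_all _ fun x => ?_)
  · have : Measurable fun x : ℝ => densityMeasure f (Ioc x (x + t / n)) :=
      measurable_measure_prodMk_left (measurableSet_setOf_mem_Ioc measurable_id (t / n))
    exact ((measurable_const.sub this.ennreal_toReal).pow_const _).aestronglyMeasurable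
  · rw [Real.norm_eq_abs, abs_of_nonneg (pow_nonneg (sub_nonneg.2 measureReal_le_one) _)]
    exact pow_le_one₀ (sub_nonneg.2 measureReal_le_one) (sub_le_self _ measureReal_nonneg)
  · exact tendsto_one_sub_pow_sub (tendsto_mul_densityMeasure_Ioc hc h0 ht x) 1

/-- Off the null diagonal the windows become disjoint once `t / n` is below the distance of the two
points. Their masses then add and the exponential limit factorises: isolation events decorrelate
asymptotically. -/
theorem tendsto_integral_prod_one_sub_pow (hc : Continuous f) (h0 : ∀ x, 0 ≤ f x) {t : ℝ}
    (ht : 0 < t) :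
    Tendsto (fun n : ℕ => ∫ z : ℝ × ℝ, (1 - (densityMeasure f).real
        (Ioc z.1 (z.1 + t / n) ∪ Ioc z.2 (z.2 + t / n))) ^ (n - 2)
      ∂(densityMeasure f).prod (densityMeasure f)) atTop (𝓝 (spacingSurvival f t ^ 2)) := by
  have hG : spacingSurvival f t ^ 2 = ∫ z : ℝ × ℝ, Real.exp (-(t * f z.1 + t * f z.2))
      ∂(densityMeasure f).prod (densityMeasure f) := by
    rw [sq, spacingSurvival, ← integral_prod_mul]
    exact integral_congr_ae (ae_of_all _ fun z => by simp only [← Real.exp_add]; ring_nf)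
  rw [hG]
  have hdiag : ∀ᵐ z ∂(densityMeasure f).prod (densityMeasure f), z.1 ≠ z.2 := by
    rw [ae_iff]
    simpa using prod_diagonal_eq_zero (densityMeasure f)
  refine tendsto_integral_of_dominated_convergence (fun _ => 1) (fun n => ?_)
    (integrable_const 1) (fun n => ae_of_all _ fun x => ?_) ?_
  · have : Measurable fun z : ℝ × ℝ =>
        densityMeasure f (Ioc z.1 (z.1 + t / n) ∪ Ioc z.2 (z.2 + t / n)) :=
      measurable_measure_prodMk_left ((measurableSet_setOf_mem_Ioc measurable_fst (t / n)).union
        (measurableSet_setOf_mem_Ioc measurable_snd (t / n)))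
    exact ((measurable_const.sub this.ennreal_toReal).pow_const _).aestronglyMeasurable
  · rw [Real.norm_eq_abs, abs_of_nonneg (pow_nonneg (sub_nonneg.2 measureReal_le_one) _)]
    exact pow_le_one₀ (sub_nonneg.2 measureReal_le_one) (sub_le_self _ measureReal_nonneg)
  · filter_upwards [hdiag] with z hz
    refine tendsto_one_sub_pow_sub ?_ 2
    have hadd := (tendsto_mul_densityMeasure_Ioc hc h0 ht z.1).add
      (tendsto_mul_densityMeasure_Ioc hc h0 ht z.2)
    refine hadd.congr' ?_
    filter_upwards [(tendsto_const_div_atTop_nhds_zero_nat t).eventually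
      (gt_mem_nhds (abs_pos.2 (sub_ne_zero.2 hz)))] with n hn
    rw [measureReal_union _ measurableSet_Ioc, mul_add]
    rw [Set.disjoint_left]
    rintro y ⟨h1, h2⟩ ⟨h3, h4⟩
    rcases abs_cases (z.1 - z.2) with h | h <;> linarith

/-- Among `n` observations, the number of those without a neighbour within `s` to the right. -/
noncomputable def isolatedCount {Ω : Type*} (X : ℕ → Ω → ℝ) (n : ℕ) (s : ℝ) (ω : Ω) : ℝ :=
  ∑ i ∈ Finset.range n, (rightIsolated X n s i).indicator (fun _ => (1 : ℝ)) ω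

/-- The events are arbitrary; only their single and pairwise probabilities enter. This serves both
the dependent isolation events and the independent window events. -/
theorem integral_sq_sum_indicator_div_sub {Ω : Type*} [MeasurableSpace Ω] {P : Measure Ω}
    [IsProbabilityMeasure P] {A : ℕ → Set Ω} (hA : ∀ i, MeasurableSet (A i)) (n : ℕ) (g : ℝ) :
    ∫ ω, ((∑ i ∈ Finset.range n, (A i).indicator (fun _ => (1 : ℝ)) ω) / n - g) ^ 2 ∂P =
      (∑ i ∈ Finset.range n, ∑ j ∈ Finset.range n, P.real (A i ∩ A j)) / n ^ 2 -
        2 * g * ((∑ i ∈ Finset.range n, P.real (A i)) / n) + g ^ 2 := by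
  have hexp : ∀ ω, ((∑ i ∈ Finset.range n, (A i).indicator (fun _ => (1 : ℝ)) ω) / n - g) ^ 2 =
      (∑ i ∈ Finset.range n, ∑ j ∈ Finset.range n,
        (A i ∩ A j).indicator (fun _ => (1 : ℝ)) ω) / n ^ 2 -
        2 * g * ((∑ i ∈ Finset.range n, (A i).indicator (fun _ => (1 : ℝ)) ω) / n) + g ^ 2 := by
    intro ω
    have : ∑ i ∈ Finset.range n, ∑ j ∈ Finset.range n,
        (A i ∩ A j).indicator (fun _ => (1 : ℝ)) ω =
        (∑ i ∈ Finset.range n, (A i).indicator (fun _ => (1 : ℝ)) ω) ^ 2 := by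
      rw [sq, Finset.sum_mul_sum]
      refine Finset.sum_congr rfl fun i _ => Finset.sum_congr rfl fun j _ => ?_
      by_cases hi : ω ∈ A i <;> by_cases hj : ω ∈ A j <;> simp [hi, hj]
    rw [this]
    ring
  have hint : ∀ B : Set Ω, MeasurableSet B → Integrable (B.indicator fun _ => (1 : ℝ)) P :=
    fun B hB => (integrable_const 1).indicator hB
  have hval : ∀ B : Set Ω, MeasurableSet B →
      ∫ ω, B.indicator (fun _ => (1 : ℝ)) ω ∂P = P.real B := fun B hB => by
    rw [integral_indicator_const _ hB, smul_eq_mul, mul_one]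
  have h1 : Integrable (fun ω => ∑ i ∈ Finset.range n, (A i).indicator (fun _ => (1 : ℝ)) ω) P :=
    integrable_finsetSum _ fun i _ => hint _ (hA i)
  have h2' : ∀ i, Integrable (fun ω => ∑ j ∈ Finset.range n,
      (A i ∩ A j).indicator (fun _ => (1 : ℝ)) ω) P := fun i =>
    integrable_finsetSum _ fun j _ => hint _ ((hA i).inter (hA j))
  have h2 : Integrable (fun ω => ∑ i ∈ Finset.range n, ∑ j ∈ Finset.range n,
      (A i ∩ A j).indicator (fun _ => (1 : ℝ)) ω) P := integrable_finsetSum _ fun i _ => h2' i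
  have hlin : ∀ Q L : Ω → ℝ, Integrable Q P → Integrable L P → ∀ a b c d : ℝ,
      ∫ ω, (Q ω / a - b * (L ω / c) + d) ∂P =
        (∫ ω, Q ω ∂P) / a - b * ((∫ ω, L ω ∂P) / c) + d := by
    intro Q L hQ hL a b c d
    rw [integral_add (f := fun ω => Q ω / a - b * (L ω / c))
      ((hQ.div_const _).sub ((hL.div_const _).const_mul _)) (integrable_const _),
      integral_sub (f := fun ω => Q ω / a) (hQ.div_const _) ((hL.div_const _).const_mul _),
      integral_div, integral_const_mul, integral_div]
    simp
  simp_rw [hexp]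
  rw [hlin _ _ h2 h1, integral_finsetSum _ fun i _ => hint _ (hA i),
    integral_finsetSum _ fun i _ => h2' i]
  have e2 : ∀ i ∈ Finset.range n, ∫ ω, ∑ j ∈ Finset.range n,
      (A i ∩ A j).indicator (fun _ => (1 : ℝ)) ω ∂P =
        ∑ j ∈ Finset.range n, P.real (A i ∩ A j) := fun i _ => by
    rw [integral_finsetSum _ fun j _ => hint _ ((hA i).inter (hA j))]
    exact Finset.sum_congr rfl fun j _ => hval _ ((hA i).inter (hA j))
  rw [Finset.sum_congr rfl e2, Finset.sum_congr rfl fun i _ => hval _ (hA i)]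

/-- Markov's inequality for the square. -/
theorem measureReal_le_abs_le_integral_sq_div {Ω : Type*} [MeasurableSpace Ω] {P : Measure Ω}
    {Y : Ω → ℝ} (hY : Integrable (fun ω => Y ω ^ 2) P) {ε : ℝ} (hε : 0 < ε) :
    P.real {ω | ε ≤ |Y ω|} ≤ (∫ ω, Y ω ^ 2 ∂P) / ε ^ 2 := by
  have h := mul_meas_ge_le_integral_of_nonneg (ae_of_all P fun ω => sq_nonneg (Y ω)) hY (ε ^ 2)
  rw [le_div_iff₀ (pow_pos hε 2), mul_comm]
  have hset : {ω | ε ≤ |Y ω|} = {ω | ε ^ 2 ≤ Y ω ^ 2} := by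
    ext ω
    simp only [mem_ofPred_eq]
    rw [← sq_abs (Y ω), pow_le_pow_iff_left₀ hε.le (abs_nonneg _) two_ne_zero]
  rwa [hset]

theorem tendsto_measureReal_isolatedCount {Ω : Type*} [MeasurableSpace Ω] {P : Measure Ω}
    [IsProbabilityMeasure P] {X : ℕ → Ω → ℝ} (hXm : ∀ i, Measurable (X i)) (hX : iIndepFun X P)
    (hlaw : ∀ i, P.map (X i) = densityMeasure f) (hc : Continuous f) (h0 : ∀ x, 0 ≤ f x) {t : ℝ}
    (ht : 0 < t) {ε : ℝ} (hε : 0 < ε) :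
    Tendsto (fun n : ℕ => P.real {ω | ε ≤ |isolatedCount X n (t / n) ω / n - spacingSurvival f t|})
      atTop (𝓝 0) := by
  set g := spacingSurvival f t with hg
  set u : ℕ → ℝ := fun n => ∫ x, (1 - (densityMeasure f).real (Ioc x (x + t / n))) ^ (n - 1)
      ∂densityMeasure f with hu
  set w : ℕ → ℝ := fun n => ∫ z : ℝ × ℝ, (1 - (densityMeasure f).real
        (Ioc z.1 (z.1 + t / n) ∪ Ioc z.2 (z.2 + t / n))) ^ (n - 2)
      ∂(densityMeasure f).prod (densityMeasure f) with hw
  have hulim : Tendsto u atTop (𝓝 g) := tendsto_integral_one_sub_pow hc h0 ht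
  have hwlim : Tendsto w atTop (𝓝 (g ^ 2)) := tendsto_integral_prod_one_sub_pow hc h0 ht
  -- The bound on the second moment tends to `g ^ 2 - 2 * g * g + g ^ 2 = 0`.
  have hbound : Tendsto (fun n : ℕ => ((1 / (n : ℝ)) * u n + w n - 2 * g * u n + g ^ 2) / ε ^ 2)
      atTop (𝓝 0) := by
    have := (((((tendsto_one_div_atTop_nhds_zero_nat (𝕜 := ℝ)).mul hulim).add hwlim).sub
      (hulim.const_mul (2 * g))).add_const (g ^ 2)).div_const (ε ^ 2)
    convert this using 2
    ring
  refine squeeze_zero' (Eventually.of_forall fun n => measureReal_nonneg) ?_ hbound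
  filter_upwards [eventually_gt_atTop 0] with n hn
  have hn' : (0 : ℝ) < n := Nat.cast_pos.2 hn
  have hA := measurableSet_rightIsolated hXm n (t / n)
  have hmeas : Measurable (isolatedCount X n (t / n)) :=
    Finset.measurable_fun_sum _ fun i _ => measurable_const.indicator (hA i)
  have hint : Integrable (fun ω => (isolatedCount X n (t / n) ω / n - g) ^ 2) P := by
    refine (integrable_const ((1 + |g|) ^ 2)).mono'
      (((hmeas.div_const _).sub_const _).pow_const _).aestronglyMeasurable (ae_of_all _ fun ω => ?_)
    rw [Real.norm_eq_abs, abs_pow]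
    refine pow_le_pow_left₀ (abs_nonneg _) ((abs_sub _ _).trans (add_le_add_left ?_ _)) 2
    rw [abs_div, Nat.abs_cast, div_le_one hn']
    refine (Finset.abs_sum_le_sum_abs _ _).trans ?_
    refine (Finset.sum_le_sum (g := fun _ => (1 : ℝ)) fun i _ => ?_).trans (by simp)
    by_cases h : ω ∈ rightIsolated X n (t / n) i <;> simp [h]
  refine (measureReal_le_abs_le_integral_sq_div hint hε).trans ?_
  refine div_le_div_of_nonneg_right ?_ (sq_nonneg ε)
  have hw0 : 0 ≤ w n := integral_nonneg fun z => pow_nonneg (sub_nonneg.2 measureReal_le_one) _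
  have hP : ∀ i ∈ Finset.range n, P.real (rightIsolated X n (t / n) i) = u n := fun i hi =>
    measureReal_rightIsolated hXm hX hlaw (Finset.mem_range.1 hi) _
  unfold isolatedCount
  rw [integral_sq_sum_indicator_div_sub hA, Finset.sum_congr rfl hP]
  -- The `n` diagonal terms contribute `u n` each, and every off-diagonal pair at most `w n`.
  have hpair : ∑ i ∈ Finset.range n, ∑ j ∈ Finset.range n,
      P.real (rightIsolated X n (t / n) i ∩ rightIsolated X n (t / n) j) ≤ n * u n + n ^ 2 * w n := by
    have : ∀ i ∈ Finset.range n, ∑ j ∈ Finset.range n,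
        P.real (rightIsolated X n (t / n) i ∩ rightIsolated X n (t / n) j) ≤ u n + n * w n := by
      intro i hi
      have hle : ∀ j ∈ Finset.range n,
          P.real (rightIsolated X n (t / n) i ∩ rightIsolated X n (t / n) j) ≤
            (if i = j then u n else 0) + w n := by
        intro j hj
        by_cases hij : i = j
        · subst hij
          rw [inter_self, hP i hi, if_pos rfl]
          linarith
        · rw [if_neg hij, zero_add]
          exact measureReal_rightIsolated_inter_le hXm hX hlaw (Finset.mem_range.1 hi)
            (Finset.mem_range.1 hj) hij _
      refine (Finset.sum_le_sum hle).trans_eq ?_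
      rw [Finset.sum_add_distrib, Finset.sum_ite_eq, if_pos hi]
      simp
    refine (Finset.sum_le_sum this).trans_eq ?_
    simp
    ring
  have h1 : (∑ i ∈ Finset.range n, ∑ j ∈ Finset.range n,
      P.real (rightIsolated X n (t / n) i ∩ rightIsolated X n (t / n) j)) / n ^ 2 ≤
      1 / n * u n + w n := by
    rw [div_le_iff₀ (pow_pos hn' 2)]
    refine hpair.trans_eq ?_
    field_simp
  have h2 : (∑ i ∈ Finset.range n, u n) / n = u n := by
    rw [Finset.sum_const, Finset.card_range, nsmul_eq_mul]
    field_simp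
  rw [h2]
  linarith

end Spacings

/-! ### Calculus of events whose probability tends to one -/

section HighProbability

variable {Ω : Type*} [MeasurableSpace Ω] {P : Measure Ω}

/-- The event `p n` fails with a probability that tends to zero. -/
def WithHighProbability (P : Measure Ω) (p : ℕ → Ω → Prop) : Prop :=
  Tendsto (fun n => P {ω | ¬ p n ω}) atTop (𝓝 0)

theorem WithHighProbability.mono {p q : ℕ → Ω → Prop} (h : WithHighProbability P p)
    (hpq : ∀ᶠ n in atTop, ∀ ω, p n ω → q n ω) : WithHighProbability P q :=
  tendsto_of_tendsto_of_tendsto_of_le_of_le' tendsto_const_nhds h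
    (Eventually.of_forall fun _ => zero_le)
    (hpq.mono fun _ hn => measure_mono fun ω hω hp => hω (hn ω hp))

theorem WithHighProbability.and {p q : ℕ → Ω → Prop} (hp : WithHighProbability P p)
    (hq : WithHighProbability P q) : WithHighProbability P fun n ω => p n ω ∧ q n ω := by
  have h := Tendsto.add hp hq
  rw [add_zero] at h
  refine tendsto_of_tendsto_of_tendsto_of_le_of_le tendsto_const_nhds h (fun _ => zero_le)
    fun n => ?_
  refine (measure_mono fun ω hω => ?_).trans (measure_union_le _ _)
  by_contra hcon
  simp only [mem_union, mem_ofPred_eq, not_or, not_not] at hcon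
  exact hω hcon

theorem WithHighProbability.of_ae {p : ℕ → Ω → Prop} (h : ∀ n, ∀ᵐ ω ∂P, p n ω) :
    WithHighProbability P p := by
  have : (fun n => P {ω | ¬ p n ω}) = fun _ => 0 := funext fun n => ae_iff.1 (h n)
  rw [WithHighProbability, this]
  exact tendsto_const_nhds

theorem WithHighProbability.finset_forall {ι : Type*} (s : Finset ι) {p : ι → ℕ → Ω → Prop}
    (h : ∀ i ∈ s, WithHighProbability P (p i)) :
    WithHighProbability P fun n ω => ∀ i ∈ s, p i n ω := by
  classical
  induction s using Finset.induction_on with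
  | empty => exact .of_ae fun n => ae_of_all _ fun ω => by simp
  | insert a s _ ih =>
    refine ((h a (Finset.mem_insert_self a s)).and
      (ih fun i hi => h i (Finset.mem_insert_of_mem hi))).mono (Eventually.of_forall fun n ω hω => ?_)
    rintro i hi
    rcases Finset.mem_insert.1 hi with rfl | hi
    exacts [hω.1, hω.2 i hi]

theorem withHighProbability_of_measureReal [IsFiniteMeasure P] {p : ℕ → Ω → Prop}
    (h : Tendsto (fun n => P.real {ω | ¬ p n ω}) atTop (𝓝 0)) : WithHighProbability P p := by
  have h2 := ENNReal.tendsto_ofReal h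
  rw [ENNReal.ofReal_zero] at h2
  exact h2.congr fun n => ofReal_measureReal (measure_ne_top _ _)

theorem tendstoInMeasure_of_withHighProbability {Y : ℕ → Ω → ℝ} {c : ℝ}
    (h : ∀ ε, 0 < ε → WithHighProbability P fun n ω => |Y n ω - c| < ε) :
    TendstoInMeasure P Y atTop fun _ => c := by
  rw [tendstoInMeasure_iff_dist]
  intro ε hε
  simpa only [WithHighProbability, not_lt, Real.dist_eq] using h ε hε

end HighProbability

/-! ### From isolated observations to the empirical quantile of the spacings -/

section Order

theorem orderStat_strictMono {n : ℕ} {x : Fin n → ℝ} (hx : Function.Injective x) :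
    StrictMono (orderStat x) :=
  (Tuple.monotone_sort x).strictMono_of_injective (hx.comp (Tuple.sort x).injective)

theorem card_isolated_orderStat {n : ℕ} (x : Fin n → ℝ) (s : ℝ) :
    (Finset.univ.filter fun i => ∀ j, orderStat x j ∉ Ioc (orderStat x i) (orderStat x i + s)).card =
      (Finset.univ.filter fun i => ∀ j, x j ∉ Ioc (x i) (x i + s)).card := by
  refine Finset.card_equiv (Tuple.sort x) fun i => ?_
  rw [Finset.mem_filter, Finset.mem_filter]
  simp only [Finset.mem_univ, true_and, orderStat]
  exact ⟨fun h j => by simpa using h ((Tuple.sort x).symm j), fun h j => h _⟩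

/-- Without ties, the observations without a right neighbour within distance `s` are the left end
points of the spacings larger than `s` and the maximum. -/
theorem card_isolated_eq_card_spacing_add_one {m : ℕ} {x : Fin (m + 1) → ℝ}
    (hx : Function.Injective x) (s : ℝ) :
    (Finset.univ.filter fun i => ∀ j, x j ∉ Ioc (x i) (x i + s)).card =
      (Finset.univ.filter fun i : Fin (m + 1 - 1) => s < spacing x i).card + 1 := by
  have hmono := orderStat_strictMono hx
  rw [← card_isolated_orderStat, Finset.card_filter, Finset.card_filter, Fin.sum_univ_castSucc]
  congr 1
  · refine Finset.sum_congr rfl fun i _ => ?_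
    refine if_congr ⟨fun h => ?_, fun h j hj => ?_⟩ rfl rfl
    · have h1 := h i.succ
      have h2 := hmono (Fin.castSucc_lt_succ (i := i))
      rw [mem_Ioc, not_and, not_le] at h1
      exact lt_sub_iff_add_lt'.2 (h1 h2)
    · have h1 : i.castSucc < j := hmono.lt_iff_lt.1 hj.1
      have h2 : orderStat x i.succ ≤ orderStat x j := hmono.monotone (Fin.castSucc_lt_iff_succ_le.1 h1)
      have h3 : s < orderStat x i.succ - orderStat x i.castSucc := h
      linarith [hj.2]
  · rw [if_pos]
    intro j hj
    exact absurd (hmono.monotone (Fin.le_last j)) (not_le.2 hj.1)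

/-- Positivity of `α` makes every admissible level at least the smallest value, so the set defining
the quantile is bounded below and its infimum is meaningful. -/
theorem empiricalQuantile_le {m : ℕ} {α t : ℝ} {y : Fin m → ℝ} (hα : 0 < α) (hm : 0 < m)
    (h : α * m ≤ ((Finset.univ.filter fun i => y i ≤ t).card : ℝ)) :
    empiricalQuantile α y ≤ t := by
  have hm' : (0 : ℝ) < m := Nat.cast_pos.2 hm
  have : Nonempty (Fin m) := ⟨⟨0, hm⟩⟩
  obtain ⟨i₀, hi₀⟩ := exists_eq_ciInf_of_finite (f := y)
  refine csInf_le ⟨⨅ i, y i, fun r hr => ?_⟩ ((le_div_iff₀ hm').2 h)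
  have hpos : 0 < (Finset.univ.filter fun i => y i ≤ r).card := by
    by_contra h0
    have h0' : (Finset.univ.filter fun i => y i ≤ r).card = 0 := by omega
    rw [mem_ofPred_eq, h0', Nat.cast_zero, zero_div] at hr
    linarith
  obtain ⟨i, hi⟩ := Finset.card_pos.1 hpos
  exact (ciInf_le (finite_range y).bddBelow i).trans (Finset.mem_filter.1 hi).2

theorem le_empiricalQuantile {m : ℕ} {α t : ℝ} {y : Fin m → ℝ} (hα : α ≤ 1) (hm : 0 < m)
    (h : ((Finset.univ.filter fun i => y i ≤ t).card : ℝ) < α * m) :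
    t ≤ empiricalQuantile α y := by
  have hm' : (0 : ℝ) < m := Nat.cast_pos.2 hm
  refine le_csInf ⟨⨆ i, y i, ?_⟩ fun r hr => ?_
  · have : (Finset.univ.filter fun i => y i ≤ ⨆ j, y j) = Finset.univ :=
      Finset.filter_true_of_mem fun i _ => le_ciSup (finite_range y).bddAbove i
    rw [mem_ofPred_eq, this, Finset.card_univ, Fintype.card_fin, div_self hm'.ne']
    exact hα
  · by_contra hlt
    rw [mem_ofPred_eq, le_div_iff₀ hm'] at hr
    have : (Finset.univ.filter fun i => y i ≤ r).card ≤ (Finset.univ.filter fun i => y i ≤ t).card :=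
      Finset.card_le_card (Finset.monotone_filter_right _ fun i _ hi => hi.trans (not_le.1 hlt).le)
    have : ((Finset.univ.filter fun i => y i ≤ r).card : ℝ) ≤
      (Finset.univ.filter fun i => y i ≤ t).card := by exact_mod_cast this
    linarith

theorem isolatedCount_eq_card {Ω : Type*} (X : ℕ → Ω → ℝ) (n : ℕ) (s : ℝ) (ω : Ω) :
    isolatedCount X n s ω = ((Finset.univ.filter fun i => ∀ j,
      sample X n ω j ∉ Ioc (sample X n ω i) (sample X n ω i + s)).card : ℝ) := by
  classical
  rw [Finset.card_filter, isolatedCount, Finset.sum_range, Nat.cast_sum]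
  refine Finset.sum_congr rfl fun i _ => ?_
  rw [indicator_apply, Nat.cast_ite, Nat.cast_one, Nat.cast_zero]
  refine if_congr ⟨fun h j => h j (Finset.mem_range.2 j.2), fun h j hj => ?_⟩ rfl rfl
  exact h ⟨j, Finset.mem_range.1 hj⟩

/-- The maximum, always isolated, compensates for there being only `n - 1` spacings: `(n - 1) -
(isolated - 1) = n - isolated`. -/
theorem card_spacing_le_eq {Ω : Type*} {X : ℕ → Ω → ℝ} {n : ℕ} (hn : 0 < n) (s : ℝ)
    {ω : Ω} (hinj : Function.Injective fun i => X i ω) :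
    ((Finset.univ.filter fun i => spacing (sample X n ω) i ≤ s).card : ℝ) =
      n - isolatedCount X n s ω := by
  obtain ⟨m, rfl⟩ : ∃ m, n = m + 1 := ⟨n - 1, by omega⟩
  have hx : Function.Injective (sample X (m + 1) ω) := fun i j h => Fin.ext (hinj h)
  rw [isolatedCount_eq_card, card_isolated_eq_card_spacing_add_one hx s]
  have h := Finset.card_filter_add_card_filter_not (s := Finset.univ)
    (fun i => spacing (sample X (m + 1) ω) i ≤ s)
  simp only [not_le, Finset.card_univ, Fintype.card_fin] at h
  have h' : (((Finset.univ.filter fun i => spacing (sample X (m + 1) ω) i ≤ s).card : ℝ) +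
    (Finset.univ.filter fun i => s < spacing (sample X (m + 1) ω) i).card) = m := by
    exact_mod_cast h
  push_cast
  linarith

end Order

/-! ### Convergence of the rescaled quantile -/

section Quantile

variable {f : ℝ → ℝ} [IsProbabilityMeasure (densityMeasure f)] {Ω : Type*} [MeasurableSpace Ω]
  {P : Measure Ω} [IsProbabilityMeasure P] {X : ℕ → Ω → ℝ}

theorem withHighProbability_isolatedCount (hXm : ∀ i, Measurable (X i)) (hX : iIndepFun X P)
    (hlaw : ∀ i, P.map (X i) = densityMeasure f) (hc : Continuous f) (h0 : ∀ x, 0 ≤ f x) {t : ℝ}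
    (ht : 0 < t) {ε : ℝ} (hε : 0 < ε) :
    WithHighProbability P fun n ω => (Function.Injective fun i => X i ω) ∧
      |isolatedCount X n (t / n) ω / n - spacingSurvival f t| < ε := by
  refine (WithHighProbability.of_ae fun n => ae_injective hXm hX hlaw).and
    (withHighProbability_of_measureReal ?_)
  simpa only [not_lt] using tendsto_measureReal_isolatedCount hXm hX hlaw hc h0 ht hε

theorem withHighProbability_spacingQuantile_le (hXm : ∀ i, Measurable (X i)) (hX : iIndepFun X P)
    (hlaw : ∀ i, P.map (X i) = densityMeasure f) (hc : Continuous f) (h0 : ∀ x, 0 ≤ f x) {t α : ℝ}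
    (ht : 0 < t) (hα : 0 < α) (h : spacingSurvival f t < 1 - α) :
    WithHighProbability P fun n ω => spacingQuantile α (sample X n ω) ≤ t / n := by
  refine (withHighProbability_isolatedCount hXm hX hlaw hc h0 ht (sub_pos.2 h)).mono ?_
  filter_upwards [eventually_ge_atTop 2] with n hn ω hω
  have hn' : (0 : ℝ) < n := Nat.cast_pos.2 (by omega)
  refine empiricalQuantile_le hα (by omega) ?_
  rw [card_spacing_le_eq (by omega) _ hω.1, Nat.cast_sub (by omega)]
  have h1 : isolatedCount X n (t / n) ω / n < 1 - α := by linarith [(abs_lt.1 hω.2).2]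
  rw [div_lt_iff₀ hn'] at h1
  push_cast
  linarith

theorem withHighProbability_le_spacingQuantile (hXm : ∀ i, Measurable (X i)) (hX : iIndepFun X P)
    (hlaw : ∀ i, P.map (X i) = densityMeasure f) (hc : Continuous f) (h0 : ∀ x, 0 ≤ f x) {t α : ℝ}
    (ht : 0 < t) (hα : α ≤ 1) (h : 1 - α < spacingSurvival f t) :
    WithHighProbability P fun n ω => t / n ≤ spacingQuantile α (sample X n ω) := by
  set ε := (spacingSurvival f t - (1 - α)) / 2 with hε
  have hε0 : 0 < ε := by rw [hε]; linarith
  refine (withHighProbability_isolatedCount hXm hX hlaw hc h0 ht hε0).mono ?_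
  -- The counts are normalised by `n` but the quantile by `n - 1`. In this direction the discrepancy
  -- `α ≤ 1` must be absorbed by the slack `n * ε > 1`.
  obtain ⟨n₀, hn₀⟩ := exists_nat_gt (1 / ε)
  filter_upwards [eventually_ge_atTop (n₀ + 2)] with n hn ω hω
  have hn' : (0 : ℝ) < n := Nat.cast_pos.2 (by omega)
  have hnn : 1 < n * ε := by
    have : (n₀ : ℝ) ≤ n := by exact_mod_cast (by omega : n₀ ≤ n)
    exact (div_lt_iff₀ hε0).1 (hn₀.trans_le this)
  refine le_empiricalQuantile hα (by omega) ?_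
  rw [card_spacing_le_eq (by omega) _ hω.1, Nat.cast_sub (by omega)]
  have h1 : 1 - α + ε < isolatedCount X n (t / n) ω / n := by linarith [(abs_lt.1 hω.2).1]
  rw [lt_div_iff₀ hn'] at h1
  push_cast
  linarith

/-- The rescaled empirical quantile of the spacings converges to the quantile of the mixture of
exponential distributions. -/
theorem withHighProbability_abs_mul_spacingQuantile_sub (hXm : ∀ i, Measurable (X i))
    (hX : iIndepFun X P) (hlaw : ∀ i, P.map (X i) = densityMeasure f) (hc : Continuous f)
    (h0 : ∀ x, 0 ≤ f x) {τ α : ℝ} (hα : α ∈ Ioo (0 : ℝ) 1) (hτ : 0 < τ)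
    (h : spacingSurvival f τ = 1 - α) {ε : ℝ} (hε : 0 < ε) :
    WithHighProbability P fun n ω => |n * spacingQuantile α (sample X n ω) - τ| < ε := by
  set δ := min (ε / 2) (τ / 2) with hδ
  have hδ0 : 0 < δ := lt_min (half_pos hε) (half_pos hτ)
  have hδε : δ < ε := (min_le_left _ _).trans_lt (half_lt_self hε)
  have hδτ : 0 < τ - δ := sub_pos.2 ((min_le_right _ _).trans_lt (half_lt_self hτ))
  have hanti := spacingSurvival_strictAntiOn hc h0
  have h1 := withHighProbability_spacingQuantile_le hXm hX hlaw hc h0 (t := τ + δ) (by positivity)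
    hα.1 (h ▸ hanti hτ.le (by positivity : 0 ≤ τ + δ) (by linarith))
  have h2 := withHighProbability_le_spacingQuantile hXm hX hlaw hc h0 (t := τ - δ) hδτ
    hα.2.le (h ▸ hanti hδτ.le hτ.le (by linarith))
  refine (h1.and h2).mono ?_
  filter_upwards [eventually_gt_atTop 0] with n hn ω hω
  have hn' : (0 : ℝ) < n := Nat.cast_pos.2 hn
  have h3 := (le_div_iff₀' hn').1 hω.1
  have h4 := (div_le_iff₀' hn').1 hω.2
  rw [abs_lt]
  constructor <;> linarith

end Quantile

/-! ### Exponential localisation of the natural cubic spline -/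

section Spline

theorem splineMatrix_mulVec_splineMoment (θ : ℝ) (B : ℕ) (y : ℕ → ℝ) :
    (splineMatrix B).mulVec (fun i : Fin B => splineMoment θ B y i) = splineRhs θ B y := by
  have h : (fun i : Fin B => splineMoment θ B y i) =
      ((splineMatrix B)⁻¹).mulVec (splineRhs θ B y) := by
    funext i
    simp [splineMoment]
  rw [h, Matrix.mulVec_mulVec,
    Matrix.mul_nonsing_inv _ (isUnit_iff_ne_zero.2 (splineMatrix_det_ne_zero B)),
    Matrix.one_mulVec]

theorem splineMoment_boundary {θ : ℝ} {B : ℕ} {y : ℕ → ℝ} {j : ℕ} (hj : j < B)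
    (h : j = 0 ∨ j + 1 = B) : splineMoment θ B y j = 0 := by
  have h1 := congr_fun (splineMatrix_mulVec_splineMoment θ B y) ⟨j, hj⟩
  simpa [Matrix.mulVec, dotProduct, splineMatrix, splineRhs, h] using h1

theorem splineMoment_interior {θ : ℝ} {B : ℕ} {y : ℕ → ℝ} {j : ℕ} (hj : j + 2 < B) :
    splineMoment θ B y j + 4 * splineMoment θ B y (j + 1) + splineMoment θ B y (j + 2) =
      6 * (y (j + 2) - 2 * y (j + 1) + y j) / θ ^ 2 := by
  have h1 := congr_fun (splineMatrix_mulVec_splineMoment θ B y) ⟨j + 1, by omega⟩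
  have hb : ¬ (j + 1 = 0 ∨ j + 1 + 1 = B) := by omega
  simp only [Matrix.mulVec, dotProduct, splineMatrix, splineRhs, Matrix.of_apply, hb,
    if_false] at h1
  have hsplit : ∀ k : Fin B, (if (⟨j + 1, by omega⟩ : Fin B) = k then (4 : ℝ) else
      if j + 1 + 1 = k.1 ∨ k.1 + 1 = j + 1 then 1 else 0) * splineMoment θ B y k =
      (if (⟨j, by omega⟩ : Fin B) = k then splineMoment θ B y k else 0) +
      (if (⟨j + 1, by omega⟩ : Fin B) = k then 4 * splineMoment θ B y k else 0) +
      (if (⟨j + 2, by omega⟩ : Fin B) = k then splineMoment θ B y k else 0) := by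
    intro k
    simp only [Fin.ext_iff]
    split_ifs <;> first | omega | ring
  rw [Finset.sum_congr rfl fun k _ => hsplit k, Finset.sum_add_distrib, Finset.sum_add_distrib] at h1
  simpa using h1

/-- The weight by which the spline system damps the influence of node `j` at node `i`. -/
noncomputable def dampingWeight (i j : ℕ) : ℝ := (2 / 3 : ℝ) ^ Nat.dist i j

theorem dampingWeight_pos (i j : ℕ) : 0 < dampingWeight i j := by
  unfold dampingWeight
  positivity

/-- Moving one node costs a factor of at most `3 / 2`. The base `2 / 3` is admissible because the
two off-diagonal entries, so inflated, sum to `3 < 4`, and dominance survives the weighting. -/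
theorem dampingWeight_le {i j k : ℕ} (h : Nat.dist j k ≤ 1) :
    dampingWeight i j ≤ 3 / 2 * dampingWeight i k := by
  have h1 : Nat.dist i k ≤ Nat.dist i j + 1 :=
    (Nat.dist.triangle_inequality i j k).trans (by omega)
  have h2 : (2 / 3 : ℝ) ^ (Nat.dist i j + 1) ≤ (2 / 3 : ℝ) ^ Nat.dist i k :=
    pow_le_pow_of_le_one (by norm_num) (by norm_num) h1
  unfold dampingWeight
  rw [pow_succ] at h2
  linarith

theorem dampingWeight_mul_le {i j k : ℕ} (h : Nat.dist j k ≤ 1) {a D : ℝ}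
    (ha : dampingWeight i k * |a| ≤ D) : dampingWeight i j * |a| ≤ 3 / 2 * D := by
  have := mul_le_mul_of_nonneg_right (dampingWeight_le (i := i) h) (abs_nonneg a)
  linarith

/-- The second derivatives of the natural spline depend on the data with exponentially decaying
weights. -/
theorem dampingWeight_mul_splineMoment_le {θ : ℝ} (hθ : 0 < θ) {B : ℕ} {y : ℕ → ℝ} {c D : ℝ}
    {i : ℕ} (hD : ∀ j < B, dampingWeight i j * |y j - c| ≤ D) {j : ℕ} (hj : j < B) :
    dampingWeight i j * |splineMoment θ B y j| ≤ 30 * D / θ ^ 2 := by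
  have hD0 : 0 ≤ D := (mul_nonneg (dampingWeight_pos i j).le (abs_nonneg _)).trans (hD j hj)
  have hR0 : 0 ≤ 30 * D / θ ^ 2 := by positivity
  -- A discrete maximum principle: the spline equation is read at the node where the weighted moment
  -- is largest. At an outer node the moment vanishes.
  obtain ⟨k, hk, hmax⟩ := Finset.exists_max_image (Finset.range B)
    (fun k => dampingWeight i k * |splineMoment θ B y k|) ⟨j, Finset.mem_range.2 hj⟩
  rw [Finset.mem_range] at hk
  refine (hmax j (Finset.mem_range.2 hj)).trans ?_
  by_cases hb : k = 0 ∨ k + 1 = B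
  · simpa [splineMoment_boundary hk hb] using hR0
  obtain ⟨l, rfl⟩ : ∃ l, k = l + 1 := ⟨k - 1, by omega⟩
  have hl : l + 2 < B := by omega
  have heq := splineMoment_interior (θ := θ) (y := y) hl
  set w := dampingWeight i (l + 1) with hw
  set Φ := w * |splineMoment θ B y (l + 1)| with hΦ
  have hw0 : 0 < w := dampingWeight_pos _ _
  have d1 : Nat.dist (l + 1) l ≤ 1 := by simp [Nat.dist]
  have d2 : Nat.dist (l + 1) (l + 2) ≤ 1 := by simp [Nat.dist]
  have m1 := dampingWeight_mul_le d1 (hmax l (Finset.mem_range.2 (by omega)))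
  have m2 := dampingWeight_mul_le d2 (hmax (l + 2) (Finset.mem_range.2 hl))
  have e0 := hD (l + 1) hk
  have e1 := dampingWeight_mul_le d1 (hD l (by omega))
  have e2 := dampingWeight_mul_le d2 (hD (l + 2) hl)
  rw [← hw] at m1 m2 e0 e1 e2
  -- The constant is `6 * (3 / 2 + 2 + 3 / 2) = 30`. Since `c` cancels in the second difference,
  -- only the deviations from `c` enter.
  have hr : w * |6 * (y (l + 2) - 2 * y (l + 1) + y l) / θ ^ 2| ≤ 30 * D / θ ^ 2 := by
    rw [abs_div, abs_of_pos (pow_pos hθ 2), ← mul_div_assoc]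
    refine div_le_div_of_nonneg_right ?_ (by positivity)
    have : |6 * (y (l + 2) - 2 * y (l + 1) + y l)| ≤
        6 * (|y (l + 2) - c| + 2 * |y (l + 1) - c| + |y l - c|) := by
      rw [abs_mul, abs_of_pos (by norm_num : (0 : ℝ) < 6)]
      refine mul_le_mul_of_nonneg_left ?_ (by norm_num)
      rw [abs_le]
      constructor <;>
      linarith [neg_abs_le (y (l + 2) - c), le_abs_self (y (l + 2) - c), neg_abs_le (y (l + 1) - c),
        le_abs_self (y (l + 1) - c), neg_abs_le (y l - c), le_abs_self (y l - c)]
    have := mul_le_mul_of_nonneg_left this hw0.le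
    linarith
  have h4 : 4 * |splineMoment θ B y (l + 1)| ≤ |6 * (y (l + 2) - 2 * y (l + 1) + y l) / θ ^ 2| +
      |splineMoment θ B y l| + |splineMoment θ B y (l + 2)| := by
    rw [← heq]
    have : 4 * splineMoment θ B y (l + 1) = (splineMoment θ B y l +
      4 * splineMoment θ B y (l + 1) + splineMoment θ B y (l + 2)) - splineMoment θ B y l -
        splineMoment θ B y (l + 2) := by ring
    calc 4 * |splineMoment θ B y (l + 1)| = |4 * splineMoment θ B y (l + 1)| := by
          rw [abs_mul, abs_of_pos (by norm_num : (0 : ℝ) < 4)]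
      _ ≤ _ := by
          conv_lhs => rw [this]
          exact (abs_sub _ _).trans (add_le_add_left (abs_sub _ _) _)
  have h5 := mul_le_mul_of_nonneg_left h4 hw0.le
  have h6 : w * (4 * |splineMoment θ B y (l + 1)|) = 4 * Φ := by rw [hΦ]; ring
  rw [h6] at h5
  -- With `Φ` the weighted maximum, the equation gives `4 * Φ ≤ 30 * D / θ ^ 2 + 2 * (3 / 2) * Φ`,
  -- so one `Φ` remains on the left.
  linarith

/-- The knot interval selected by the spline contains the point of evaluation. -/
theorem splineIndex_bounds {b θ x : ℝ} (hθ : 0 < θ) {B : ℕ} (hB : 2 ≤ B) (hbx : b ≤ x)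
    (hxb : x ≤ b + (B - 1 : ℕ) * θ) :
    ((min ⌊(x - b) / θ⌋₊ (B - 2) : ℕ) : ℝ) * θ ≤ x - b ∧
      x - b ≤ (((min ⌊(x - b) / θ⌋₊ (B - 2) : ℕ) : ℝ) + 1) * θ := by
  constructor
  · exact (le_div_iff₀ hθ).1 ((Nat.cast_le.2 (min_le_left _ _)).trans
      (Nat.floor_le (div_nonneg (sub_nonneg.2 hbx) hθ.le)))
  · rcases le_total ⌊(x - b) / θ⌋₊ (B - 2) with h | h
    · rw [min_eq_left h]
      exact ((div_lt_iff₀ hθ).1 (Nat.lt_floor_add_one _)).le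
    · have h1 : ((B - 2 : ℕ) : ℝ) + 1 = (B - 1 : ℕ) := by
        have : B - 1 = (B - 2) + 1 := by omega
        rw [this]
        push_cast
        ring
      rw [min_eq_right h, h1]
      linarith

/-- Local stability of the natural cubic spline: at a point between the outer nodes it is close
to `c` when the data are, in the norm damped away from that point. -/
theorem abs_naturalSpline_sub_le {b θ : ℝ} (hθ : 0 < θ) {B : ℕ} (hB : 2 ≤ B) {y : ℕ → ℝ} {x c D : ℝ}
    (hbx : b ≤ x) (hxb : x ≤ b + (B - 1 : ℕ) * θ)
    (hD : ∀ j < B, dampingWeight (min ⌊(x - b) / θ⌋₊ (B - 2)) j * |y j - c| ≤ D) :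
    |naturalSpline b θ B y x - c| ≤ 15 * D := by
  unfold naturalSpline
  simp only [not_lt.2 hbx, not_lt.2 hxb, if_false]
  set i := min ⌊(x - b) / θ⌋₊ (B - 2) with hi
  have hiB : i + 1 < B := by
    have : i ≤ B - 2 := min_le_right _ _
    omega
  obtain ⟨hi1, hi2⟩ := splineIndex_bounds hθ hB hbx hxb
  rw [← hi] at hi1 hi2
  have hs0 : 0 ≤ x - (b + i * θ) := by linarith
  have ht0 : 0 ≤ b + (i + 1) * θ - x := by linarith
  set s := x - (b + i * θ) with hs
  set t := b + (i + 1) * θ - x with ht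
  have hst : s + t = θ := by rw [hs, ht]; ring
  have w0 : dampingWeight i i = 1 := by simp [dampingWeight]
  have d1 : Nat.dist i (i + 1) ≤ 1 := by simp [Nat.dist]
  have hM0 := dampingWeight_mul_splineMoment_le hθ hD (j := i) (by omega)
  have hM1 := dampingWeight_mul_le d1 (dampingWeight_mul_splineMoment_le hθ hD hiB)
  have he0 := hD i (by omega)
  have he1 := dampingWeight_mul_le d1 (hD (i + 1) hiB)
  rw [w0, one_mul] at hM0 hM1 he0 he1
  set M0 := splineMoment θ B y i
  set M1 := splineMoment θ B y (i + 1)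
  have hD0 : 0 ≤ D := (abs_nonneg _).trans he0
  have hcubic : ∀ r, 0 ≤ r → r ≤ θ → |r ^ 3 / (6 * θ) - θ * r / 6| ≤ θ ^ 2 / 6 := by
    intro r hr hrθ
    have : r ^ 3 / (6 * θ) - θ * r / 6 = - ((r / 6) * ((θ ^ 2 - r ^ 2) / θ)) := by
      field_simp
      ring
    rw [this, abs_neg, abs_of_nonneg (mul_nonneg (by positivity)
      (div_nonneg (by nlinarith) hθ.le))]
    have h2 : (θ ^ 2 - r ^ 2) / θ ≤ θ := by
      rw [div_le_iff₀ hθ]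
      nlinarith
    calc r / 6 * ((θ ^ 2 - r ^ 2) / θ) ≤ θ / 6 * θ :=
          mul_le_mul (by linarith) h2 (div_nonneg (by nlinarith) hθ.le) (by positivity)
      _ = _ := by ring
  have hfrac : ∀ r, 0 ≤ r → r ≤ θ → |r / θ| ≤ 1 := by
    intro r hr hrθ
    rw [abs_of_nonneg (div_nonneg hr hθ.le)]
    exact (div_le_one hθ).2 hrθ
  -- Regrouping shows a cubic correction of size at most `θ ^ 2 / 6` per moment plus linear
  -- interpolation of the deviations. The four terms are bounded by `15 / 2 * D`, `5 * D`, `3 / 2 *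
  -- D` and `D`, with sum `15 * D`.
  have key : M1 * s ^ 3 / (6 * θ) + M0 * t ^ 3 / (6 * θ) + (y (i + 1) / θ - M1 * θ / 6) * s +
      (y i / θ - M0 * θ / 6) * t - c =
      M1 * (s ^ 3 / (6 * θ) - θ * s / 6) + M0 * (t ^ 3 / (6 * θ) - θ * t / 6) +
        (y (i + 1) - c) * (s / θ) + (y i - c) * (t / θ) := by
    have hc : c = c * (s / θ) + c * (t / θ) := by
      rw [← mul_add, ← add_div, hst, div_self hθ.ne', mul_one]
    conv_lhs => rw [hc]
    ring
  have hmul : ∀ a r A R : ℝ, |a| ≤ A → |r| ≤ R → |a * r| ≤ A * R := by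
    intro a r A R h1 h2
    rw [abs_mul]
    exact mul_le_mul h1 h2 (abs_nonneg _) ((abs_nonneg _).trans h1)
  rw [key]
  have b1 := hmul _ _ _ _ hM1 (hcubic s hs0 (by linarith))
  have b0 := hmul _ _ _ _ hM0 (hcubic t ht0 (by linarith))
  have c1 := hmul _ _ _ _ he1 (hfrac s hs0 (by linarith))
  have c0 := hmul _ _ _ _ he0 (hfrac t ht0 (by linarith))
  have r1 : 3 / 2 * (30 * D / θ ^ 2) * (θ ^ 2 / 6) = 15 / 2 * D := by
    field_simp
    ring
  have r0 : 30 * D / θ ^ 2 * (θ ^ 2 / 6) = 5 * D := by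
    field_simp
    ring
  rw [r1] at b1
  rw [r0] at b0
  refine (abs_add_le _ _).trans ?_
  have a1 := abs_add_le (M1 * (s ^ 3 / (6 * θ) - θ * s / 6) + M0 * (t ^ 3 / (6 * θ) - θ * t / 6))
    ((y (i + 1) - c) * (s / θ))
  have a2 := abs_add_le (M1 * (s ^ 3 / (6 * θ) - θ * s / 6)) (M0 * (t ^ 3 / (6 * θ) - θ * t / 6))
  linarith

end Spline

/-! ### Window counts and the passage from a grid to all windows -/

section Counts

/-- The number of entries of a tuple in the interval `(u, v]`. -/
noncomputable def windowCount {n : ℕ} (x : Fin n → ℝ) (u v : ℝ) : ℝ :=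
  ∑ i, (Ioc u v).indicator (fun _ => (1 : ℝ)) (x i)

theorem windowCount_mono {n : ℕ} (x : Fin n → ℝ) (u : ℝ) : Monotone (windowCount x u) :=
  fun _ _ h => Finset.sum_le_sum fun _ _ =>
    indicator_le_indicator_of_subset (Ioc_subset_Ioc_right h) (fun _ => zero_le_one) _

theorem windowCount_sub {n : ℕ} (x : Fin n → ℝ) {u v w : ℝ} (huv : u ≤ v) (hvw : v ≤ w) :
    windowCount x u w - windowCount x u v = windowCount x v w := by
  unfold windowCount
  rw [sub_eq_iff_eq_add', ← Finset.sum_add_distrib]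
  refine Finset.sum_congr rfl fun i _ => ?_
  rw [← Ioc_union_Ioc_eq_Ioc huv hvw, indicator_union_of_disjoint (Ioc_disjoint_Ioc_of_le le_rfl)]

/-- The Glivenko–Cantelli argument: between grid points monotonicity squeezes `H`, and the linear
target increases by only `c / M` over a cell. The hypothesis `z * M + 1 ≤ K` keeps the right end of
the cell on the grid. -/
theorem abs_sub_mul_le_of_monotone_of_grid {H : ℝ → ℝ} (hH : Monotone H) {c ε : ℝ} (hc : 0 ≤ c)
    {M K : ℕ} (hM : 0 < M) (hgrid : ∀ g ≤ K, |H (g / M) - c * (g / M)| ≤ ε) {z : ℝ} (hz : 0 ≤ z)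
    (hzK : z * M + 1 ≤ K) : |H z - c * z| ≤ ε + c / M := by
  have hM' : (0 : ℝ) < M := Nat.cast_pos.2 hM
  have h1 : (⌊z * M⌋₊ : ℝ) ≤ z * M := Nat.floor_le (by positivity)
  have h2 : z * M < ⌊z * M⌋₊ + 1 := Nat.lt_floor_add_one _
  have hgK : ⌊z * M⌋₊ + 1 ≤ K := by
    have : ((⌊z * M⌋₊ + 1 : ℕ) : ℝ) ≤ K := by push_cast; linarith
    exact_mod_cast this
  have g1 := abs_le.1 (hgrid ⌊z * M⌋₊ (by omega))
  have g2 := abs_le.1 (hgrid (⌊z * M⌋₊ + 1) hgK)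
  push_cast at g2
  set q : ℝ := (⌊z * M⌋₊ : ℝ)
  have l1 : q / M ≤ z := (div_le_iff₀ hM').2 h1
  have l2 : z ≤ (q + 1) / M := (le_div_iff₀ hM').2 h2.le
  have l3 : z ≤ q / M + 1 / M := by rw [← add_div]; exact l2
  have m1 := hH l1
  have m2 := hH l2
  have c1 := mul_le_mul_of_nonneg_left l1 hc
  have c2 := mul_le_mul_of_nonneg_left l3 hc
  rw [mul_add, mul_one_div] at c2
  have e : c * ((q + 1) / M) = c * (q / M) + c / M := by ring
  rw [e] at g2
  rw [abs_le]
  constructor <;> linarith [g1.1, g2.2]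

theorem windowCount_sample_eq {Ω : Type*} (X : ℕ → Ω → ℝ) (n : ℕ) (u v : ℝ) (ω : Ω) :
    windowCount (sample X n ω) u v =
      ∑ i ∈ Finset.range n, (X i ⁻¹' Ioc u v).indicator (fun _ => (1 : ℝ)) ω := by
  rw [Finset.sum_range]
  rfl

end Counts

/-! ### Weak laws for counts in windows of the order of the bin width -/

section CountLimits

variable {f : ℝ → ℝ} {Ω : Type*} [MeasurableSpace Ω]
  {P : Measure Ω} [IsProbabilityMeasure P] {X : ℕ → Ω → ℝ}

/-- Chebyshev with variance at most `p / n`. Keeping the factor `p` is essential, since the windows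
shrink and `p` is of the order of their length. -/
theorem measureReal_le_abs_windowCount_div_sub {μ : Measure ℝ} (hXm : ∀ i, Measurable (X i))
    (hX : iIndepFun X P) (hlaw : ∀ i, P.map (X i) = μ) {n : ℕ} (hn : 0 < n) (u v : ℝ) {ε : ℝ}
    (hε : 0 < ε) :
    P.real {ω | ε ≤ |windowCount (sample X n ω) u v / n - μ.real (Ioc u v)|} ≤
      μ.real (Ioc u v) / (n * ε ^ 2) := by
  set p := μ.real (Ioc u v) with hp
  have hn' : (0 : ℝ) < n := Nat.cast_pos.2 hn
  have hA : ∀ i, MeasurableSet (X i ⁻¹' Ioc u v) := fun i => hXm i measurableSet_Ioc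
  have hPA : ∀ i, P.real (X i ⁻¹' Ioc u v) = p := fun i => by
    rw [hp, ← hlaw i, map_measureReal_apply (hXm i) measurableSet_Ioc]
  simp_rw [windowCount_sample_eq]
  have hint : Integrable (fun ω => ((∑ i ∈ Finset.range n,
      (X i ⁻¹' Ioc u v).indicator (fun _ => (1 : ℝ)) ω) / n - p) ^ 2) P := by
    have hmeas : Measurable (fun ω => ∑ i ∈ Finset.range n,
        (X i ⁻¹' Ioc u v).indicator (fun _ => (1 : ℝ)) ω) :=
      Finset.measurable_fun_sum _ fun i _ => measurable_const.indicator (hA i)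
    refine (integrable_const ((1 + |p|) ^ 2)).mono'
      (((hmeas.div_const _).sub_const _).pow_const _).aestronglyMeasurable (ae_of_all _ fun ω => ?_)
    rw [Real.norm_eq_abs, abs_pow]
    refine pow_le_pow_left₀ (abs_nonneg _) ((abs_sub _ _).trans (add_le_add_left ?_ _)) 2
    rw [abs_div, Nat.abs_cast, div_le_one hn']
    refine (Finset.abs_sum_le_sum_abs _ _).trans ?_
    refine (Finset.sum_le_sum (g := fun _ => (1 : ℝ)) fun i _ => ?_).trans (by simp)
    by_cases h : ω ∈ X i ⁻¹' Ioc u v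
    · rw [indicator_of_mem h, abs_one]
    · rw [indicator_of_notMem h, abs_zero]
      exact zero_le_one
  refine (measureReal_le_abs_le_integral_sq_div hint hε).trans ?_
  rw [integral_sq_sum_indicator_div_sub hA, Finset.sum_congr rfl fun i _ => hPA i]
  have hpair : ∑ i ∈ Finset.range n, ∑ j ∈ Finset.range n,
      P.real (X i ⁻¹' Ioc u v ∩ X j ⁻¹' Ioc u v) ≤ n * p + n ^ 2 * p ^ 2 := by
    have : ∀ i ∈ Finset.range n, ∑ j ∈ Finset.range n,
        P.real (X i ⁻¹' Ioc u v ∩ X j ⁻¹' Ioc u v) ≤ p + n * p ^ 2 := by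
      intro i hi
      have hle : ∀ j ∈ Finset.range n, P.real (X i ⁻¹' Ioc u v ∩ X j ⁻¹' Ioc u v) ≤
          (if i = j then p else 0) + p ^ 2 := by
        intro j _
        by_cases hij : i = j
        · subst hij
          rw [inter_self, hPA i, if_pos rfl]
          linarith [sq_nonneg p]
        · rw [if_neg hij, zero_add, sq, measureReal_def,
            (hX.indepFun hij).measure_inter_preimage_eq_mul _ _ measurableSet_Ioc measurableSet_Ioc,
            ENNReal.toReal_mul]
          exact (congr_arg₂ (· * ·) (hPA i) (hPA j)).le
      refine (Finset.sum_le_sum hle).trans_eq ?_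
      rw [Finset.sum_add_distrib, Finset.sum_ite_eq, if_pos hi]
      simp
    refine (Finset.sum_le_sum this).trans_eq ?_
    simp
    ring
  have h1 : (∑ i ∈ Finset.range n, ∑ j ∈ Finset.range n,
      P.real (X i ⁻¹' Ioc u v ∩ X j ⁻¹' Ioc u v)) / n ^ 2 ≤ p / n + p ^ 2 := by
    rw [div_le_iff₀ (pow_pos hn' 2)]
    refine hpair.trans_eq ?_
    field_simp
  have h2 : (∑ i ∈ Finset.range n, p) / n = p := by
    rw [Finset.sum_const, Finset.card_range, nsmul_eq_mul]
    field_simp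
  rw [h2, ← div_div]
  refine div_le_div_of_nonneg_right ?_ (sq_nonneg ε)
  linarith

/-- Consistency of the normalised count in a shrinking window at a fixed position. -/
theorem withHighProbability_windowCount (hXm : ∀ i, Measurable (X i)) (hX : iIndepFun X P)
    (hlaw : ∀ i, P.map (X i) = densityMeasure f) (hc : Continuous f) (h0 : ∀ x, 0 ≤ f x)
    {θ : ℕ → ℝ} (hθ : ∀ n, 0 < θ n) (hθ0 : Tendsto θ atTop (𝓝 0))
    (hnθ : Tendsto (fun n : ℕ => (n : ℝ) * θ n) atTop atTop) (x a : ℝ) {r : ℝ} (hr : 0 < r)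
    {ε : ℝ} (hε : 0 < ε) :
    WithHighProbability P fun n ω => |windowCount (sample X n ω) (x + a * θ n)
      (x + (a + r) * θ n) / (n * θ n) - f x * r| < ε := by
  have hend : ∀ b : ℝ, Tendsto (fun n => x + b * θ n) atTop (𝓝 x) := fun b => by
    simpa using (hθ0.const_mul b).const_add x
  set p : ℕ → ℝ := fun n => (densityMeasure f).real (Ioc (x + a * θ n) (x + (a + r) * θ n)) with hp
  have hlim : Tendsto (fun n => p n / θ n) atTop (𝓝 (f x * r)) := by
    have := (tendsto_densityMeasure_real_Ioc_div (l := atTop) hc h0 (Eventually.of_forall fun n => by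
      nlinarith [hθ n, mul_pos hr (hθ n)]) (hend a) (hend (a + r))).mul_const r
    refine this.congr fun n => ?_
    have h1 := (hθ n).ne'
    have : x + (a + r) * θ n - (x + a * θ n) = r * θ n := by ring
    rw [this, hp]
    field_simp
  -- A deviation of `ε / 2 * θ n` has probability at most `p n / (n * (ε / 2 * θ n) ^ 2)`. Since `p
  -- n / θ n` converges, `n * θ n → ∞` makes this vanish.
  have hbound : Tendsto (fun n : ℕ => (p n / θ n) * (((n : ℝ) * θ n)⁻¹ * (4 / ε ^ 2))) atTop
      (𝓝 0) := by
    simpa using hlim.mul ((tendsto_inv_atTop_zero.comp hnθ).mul_const (4 / ε ^ 2))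
  have hdev : WithHighProbability P fun n ω => |windowCount (sample X n ω) (x + a * θ n)
      (x + (a + r) * θ n) / n - p n| < ε / 2 * θ n := by
    refine withHighProbability_of_measureReal
      (squeeze_zero' (Eventually.of_forall fun n => measureReal_nonneg) ?_ hbound)
    filter_upwards [eventually_gt_atTop 0] with n hn
    have hn' : (0 : ℝ) < n := Nat.cast_pos.2 hn
    have h1 := hθ n
    simp only [not_lt]
    refine (measureReal_le_abs_windowCount_div_sub hXm hX hlaw hn _ _
      (ε := ε / 2 * θ n) (by positivity)).trans_eq ?_
    change p n / _ = _
    field_simp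
    ring
  refine hdev.mono ?_
  filter_upwards [eventually_gt_atTop 0, Metric.tendsto_nhds.1 hlim (ε / 2) (half_pos hε)]
    with n hn hpn ω hω
  have hn' : (0 : ℝ) < n := Nat.cast_pos.2 hn
  have h1 := hθ n
  rw [Real.dist_eq] at hpn
  set N := windowCount (sample X n ω) (x + a * θ n) (x + (a + r) * θ n)
  have h2 : |N / (n * θ n) - p n / θ n| < ε / 2 := by
    have : N / (n * θ n) - p n / θ n = (N / n - p n) / θ n := by field_simp
    rw [this, abs_div, abs_of_pos h1, div_lt_iff₀ h1]
    exact hω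
  calc |N / (n * θ n) - f x * r| ≤ |N / (n * θ n) - p n / θ n| + |p n / θ n - f x * r| :=
        abs_sub_le _ _ _
    _ < ε := by linarith

/-- Consistency of the normalised counts, uniformly over all windows at distance of the order of
the bin width. -/
theorem withHighProbability_forall_windowCount (hXm : ∀ i, Measurable (X i)) (hX : iIndepFun X P)
    (hlaw : ∀ i, P.map (X i) = densityMeasure f) (hc : Continuous f) (h0 : ∀ x, 0 ≤ f x)
    {θ : ℕ → ℝ} (hθ : ∀ n, 0 < θ n) (hθ0 : Tendsto θ atTop (𝓝 0))
    (hnθ : Tendsto (fun n : ℕ => (n : ℝ) * θ n) atTop atTop) (x W : ℝ)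
    {ε : ℝ} (hε : 0 < ε) :
    WithHighProbability P fun n ω => ∀ u v, -W ≤ u → u ≤ v → v ≤ W →
      |windowCount (sample X n ω) (x + u * θ n) (x + v * θ n) / (n * θ n) - f x * (v - u)| ≤ ε := by
  -- Grid error and cell error are each at most `ε / 4`. A window is the difference of two
  -- cumulative counts, for a total of `ε`.
  obtain ⟨M, hM⟩ := exists_nat_gt (4 * f x / ε)
  have hM0 : (0 : ℝ) < M := lt_of_le_of_lt (div_nonneg (by linarith [h0 x]) hε.le) hM
  have hcM : f x / M ≤ ε / 4 := by
    rw [div_lt_iff₀ hε] at hM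
    rw [div_le_iff₀ hM0]
    linarith
  obtain ⟨K, hK⟩ := exists_nat_ge (2 * W * M + 1)
  have hgrid := WithHighProbability.finset_forall (P := P) (Finset.range (K + 1))
    (p := fun g n ω => |windowCount (sample X n ω) (x + (-W) * θ n)
      (x + (-W + (g : ℝ) / M) * θ n) / (n * θ n) - f x * (g / M)| ≤ ε / 4) (fun g _ => by
      rcases Nat.eq_zero_or_pos g with rfl | hg
      · refine .of_ae fun n => ae_of_all _ fun ω => ?_
        simp [windowCount]
        positivity
      · exact (withHighProbability_windowCount hXm hX hlaw hc h0 hθ hθ0 hnθ x (-W)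
          (r := (g : ℝ) / M) (by positivity) (by positivity : 0 < ε / 4)).mono
            (Eventually.of_forall fun n ω h => h.le))
  refine hgrid.mono (Eventually.of_forall fun n ω hω u v hu huv hv => ?_)
  have h1 := hθ n
  set H : ℝ → ℝ := fun z => windowCount (sample X n ω) (x + (-W) * θ n)
    (x + (-W + z) * θ n) / (n * θ n) with hH
  have hmono : Monotone H := fun z₁ z₂ hz =>
    div_le_div_of_nonneg_right (windowCount_mono _ _ (by gcongr)) (by positivity)
  have hz : ∀ z, -W ≤ z → z ≤ W → |H (z + W) - f x * (z + W)| ≤ ε / 4 + f x / M := by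
    intro z hz1 hz2
    refine abs_sub_mul_le_of_monotone_of_grid hmono (h0 x) (Nat.cast_pos.1 hM0)
      (K := K)
      (fun g hg => hω g (Finset.mem_range.2 (by omega))) (by linarith) ?_
    refine le_trans ?_ hK
    have := mul_le_mul_of_nonneg_right (by linarith : z + W ≤ 2 * W) hM0.le
    linarith
  have key : windowCount (sample X n ω) (x + u * θ n) (x + v * θ n) / (n * θ n) =
      H (v + W) - H (u + W) := by
    rw [hH, ← sub_div]
    simp only [add_comm _ W, neg_add_cancel_left]
    rw [windowCount_sub _ (by gcongr) (by gcongr)]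
  have a1 := abs_le.1 (hz u hu (huv.trans hv))
  have a2 := abs_le.1 (hz v (hu.trans huv) hv)
  rw [key, abs_le]
  constructor <;> linarith [a1.1, a1.2, a2.1, a2.2]

end CountLimits

/-! ### Histogram heights compared with sums over the original observations -/

section Bins

theorem binIndex_eq_iff {o θ z : ℝ} (hθ : 0 < θ) {q : ℤ} :
    binIndex o θ z = q ↔ o + q * θ ≤ z ∧ z < o + (q + 1) * θ := by
  rw [binIndex, Int.floor_eq_iff, le_div_iff₀ hθ, div_lt_iff₀ hθ, le_sub_iff_add_le',
    sub_lt_iff_lt_add']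

variable {n m : ℕ} {o θ : ℝ} {z : Fin n × Fin m → ℝ} {g : Fin n → ℝ} {r : ℕ}

theorem binHeight_eq_sum (o θ : ℝ) (z : Fin n × Fin m → ℝ) (r : ℕ) :
    binHeight o θ z r = (∑ i, ∑ j, if binIndex o θ (z (i, j)) = firstBin o θ z + r then (1 : ℝ)
      else 0) / (n * m * θ) := by
  rw [binHeight, Finset.card_filter, Nat.cast_sum, Fintype.sum_prod_type, Fintype.card_prod,
    Fintype.card_fin, Fintype.card_fin, Nat.cast_mul]
  simp only [Nat.cast_ite, Nat.cast_one, Nat.cast_zero]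

theorem sum_div_eq_sum_sum_div (hm : 0 < m) (θ : ℝ) (g : Fin n → ℝ) :
    (∑ i, g i) / (n * θ) = (∑ i, ∑ _j : Fin m, g i) / (n * m * θ) := by
  have hm' : (m : ℝ) ≠ 0 := by positivity
  simp only [Finset.sum_const, Finset.card_univ, Fintype.card_fin, nsmul_eq_mul, ← Finset.mul_sum]
  rw [show (n : ℝ) * m * θ = m * (n * θ) by ring, mul_div_mul_left _ _ hm']

/-- The `m` pseudo-observations sharing an original index are bounded by the same `g i`, and `m`
cancels against the normalisation. No assumption on their joint law is needed. -/
theorem binHeight_le_sum (hm : 0 < m) (hθ : 0 < θ) (hg : ∀ i, 0 ≤ g i)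
    (h : ∀ p, binIndex o θ (z p) = firstBin o θ z + r → 1 ≤ g p.1) :
    binHeight o θ z r ≤ (∑ i, g i) / (n * θ) := by
  rw [binHeight_eq_sum, sum_div_eq_sum_sum_div hm]
  refine div_le_div_of_nonneg_right (Finset.sum_le_sum fun i _ => Finset.sum_le_sum fun j _ => ?_)
    (by positivity)
  split_ifs with hij
  exacts [h _ hij, hg i]

theorem sum_le_binHeight (hm : 0 < m) (hθ : 0 < θ) (hg : ∀ i, g i ≤ 1)
    (h : ∀ p, binIndex o θ (z p) ≠ firstBin o θ z + r → g p.1 ≤ 0) :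
    (∑ i, g i) / (n * θ) ≤ binHeight o θ z r := by
  rw [binHeight_eq_sum, sum_div_eq_sum_sum_div hm]
  refine div_le_div_of_nonneg_right (Finset.sum_le_sum fun i _ => Finset.sum_le_sum fun j _ => ?_)
    (by positivity)
  split_ifs with hij
  exacts [hg i, h _ hij]

theorem binHeight_nonneg {ι : Type*} [Fintype ι] {o θ : ℝ} (hθ : 0 < θ) (z : ι → ℝ) (r : ℕ) :
    0 ≤ binHeight o θ z r := by
  unfold binHeight
  positivity

theorem lowerEdge_eq (o θ : ℝ) (z : Fin n × Fin m → ℝ) (r : ℕ) :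
    o + ((firstBin o θ z + r : ℤ) : ℝ) * θ = firstMidpoint o θ z + (r - 1 / 2) * θ := by
  rw [firstMidpoint]
  push_cast
  ring

theorem firstMidpoint_le {ι : Type*} [Fintype ι] {o θ : ℝ} (hθ : 0 < θ) (z : ι → ℝ) (p : ι) :
    firstMidpoint o θ z ≤ z p + θ / 2 := by
  have h1 : firstBin o θ z ≤ binIndex o θ (z p) := ciInf_le (finite_range _).bddBelow p
  have h2 := ((binIndex_eq_iff hθ).1 (rfl : binIndex o θ (z p) = _)).1
  have h3 : (firstBin o θ z : ℝ) * θ ≤ binIndex o θ (z p) * θ :=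
    mul_le_mul_of_nonneg_right (Int.cast_le.2 h1) hθ.le
  rw [firstMidpoint]
  linarith

theorem le_lastMidpoint {ι : Type*} [Fintype ι] {o θ : ℝ} (hθ : 0 < θ) (z : ι → ℝ) (p : ι) :
    z p - θ / 2 ≤ firstMidpoint o θ z + (numBins o θ z - 1 : ℕ) * θ := by
  have h1 : firstBin o θ z ≤ binIndex o θ (z p) := ciInf_le (finite_range _).bddBelow p
  have h1' : binIndex o θ (z p) ≤ ⨆ i, binIndex o θ (z i) :=
    le_ciSup (f := fun i => binIndex o θ (z i)) (finite_range _).bddAbove p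
  have h2 := ((binIndex_eq_iff hθ).1 (rfl : binIndex o θ (z p) = _)).2
  have h3 : ((numBins o θ z - 1 : ℕ) : ℤ) = (⨆ i, binIndex o θ (z i)) - firstBin o θ z := by
    unfold numBins
    omega
  have h4 : ((numBins o θ z - 1 : ℕ) : ℝ) =
      ((⨆ i, binIndex o θ (z i) : ℤ) : ℝ) - firstBin o θ z := by
    exact_mod_cast congr_arg (Int.cast : ℤ → ℝ) h3
  have h5 : (binIndex o θ (z p) : ℝ) * θ ≤ ((⨆ i, binIndex o θ (z i) : ℤ) : ℝ) * θ :=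
    mul_le_mul_of_nonneg_right (Int.cast_le.2 h1') hθ.le
  rw [firstMidpoint, h4]
  linarith

end Bins

/-! ### A bound in probability for heights far from the point -/

section Tails

/-- A kernel average of the observations around `x₀` with polynomially decaying weights. -/
noncomputable def cauchyAverage {n : ℕ} (x₀ θ : ℝ) (x : Fin n → ℝ) : ℝ :=
  (∑ i, (1 + ((x i - x₀) / θ) ^ 2)⁻¹) / (n * θ)

variable {f : ℝ → ℝ} [IsProbabilityMeasure (densityMeasure f)]

theorem lintegral_ofReal_density (f : ℝ → ℝ) [IsProbabilityMeasure (densityMeasure f)] :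
    ∫⁻ x, ENNReal.ofReal (f x) = 1 := by
  have h : densityMeasure f univ = 1 := measure_univ
  rwa [withDensity_apply _ MeasurableSet.univ, Measure.restrict_univ] at h

theorem integrable_density (hc : Continuous f) (h0 : ∀ x, 0 ≤ f x) : Integrable f :=
  ⟨hc.aestronglyMeasurable, by
    rw [hasFiniteIntegral_iff_ofReal (ae_of_all _ h0), lintegral_ofReal_density f]
    exact ENNReal.one_lt_top⟩

theorem integral_density (hc : Continuous f) (h0 : ∀ x, 0 ≤ f x) : ∫ x, f x = 1 := by
  rw [integral_eq_lintegral_of_nonneg_ae (ae_of_all _ h0) hc.aestronglyMeasurable,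
    lintegral_ofReal_density f, ENNReal.toReal_one]

/-- Within `δ` of `x₀` the density is at most `C` and the kernel has total integral `θ * π`. Farther
out the kernel is at most `θ ^ 2 / δ ^ 2` and the density has mass one, so no global bound on `f` is
needed. -/
theorem integral_cauchyKernel_le (hc : Continuous f) (h0 : ∀ x, 0 ≤ f x) {x₀ δ C θ : ℝ}
    (hδ : 0 < δ) (hθ : 0 < θ) (hC0 : 0 ≤ C) (hC : ∀ y, |y - x₀| ≤ δ → f y ≤ C) :
    ∫ y, (1 + ((y - x₀) / θ) ^ 2)⁻¹ ∂densityMeasure f ≤ C * (θ * Real.pi) + θ ^ 2 / δ ^ 2 := by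
  have hk : Integrable fun y : ℝ => (1 + ((y - x₀) / θ) ^ 2)⁻¹ :=
    (integrable_inv_one_add_sq.comp_div hθ.ne').comp_sub_right x₀
  have hkint : ∫ y : ℝ, (1 + ((y - x₀) / θ) ^ 2)⁻¹ = θ * Real.pi := by
    rw [integral_sub_right_eq_self (fun y : ℝ => (1 + (y / θ) ^ 2)⁻¹) x₀,
      Measure.integral_comp_div (fun y : ℝ => (1 + y ^ 2)⁻¹), integral_univ_inv_one_add_sq,
      abs_of_pos hθ, smul_eq_mul]
  have hf := integrable_density hc h0
  rw [integral_withDensity_eq_integral_toReal_smul (by fun_prop)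
    (ae_of_all _ fun _ => ENNReal.ofReal_lt_top)]
  calc ∫ y, (ENNReal.ofReal (f y)).toReal • (1 + ((y - x₀) / θ) ^ 2)⁻¹
      ≤ ∫ y, (C * (1 + ((y - x₀) / θ) ^ 2)⁻¹ + θ ^ 2 / δ ^ 2 * f y) := by
        refine integral_mono_of_nonneg (ae_of_all _ fun y => ?_)
          ((hk.const_mul C).add (hf.const_mul _)) (ae_of_all _ fun y => ?_)
        · simp only [Pi.zero_apply, smul_eq_mul]
          positivity
        · simp only [smul_eq_mul]
          rw [ENNReal.toReal_ofReal (h0 y)]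
          rcases le_or_gt |y - x₀| δ with h | h
          · have := mul_le_mul_of_nonneg_right (hC y h)
              (by positivity : 0 ≤ (1 + ((y - x₀) / θ) ^ 2)⁻¹)
            have := mul_nonneg (by positivity : 0 ≤ θ ^ 2 / δ ^ 2) (h0 y)
            linarith
          · have h1 : δ ^ 2 ≤ (y - x₀) ^ 2 := by
              rw [← sq_abs (y - x₀)]
              exact pow_le_pow_left₀ hδ.le h.le 2
            have h2 : (1 + ((y - x₀) / θ) ^ 2)⁻¹ ≤ θ ^ 2 / δ ^ 2 := by
              rw [← inv_div (δ ^ 2)]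
              refine inv_anti₀ (by positivity) ?_
              rw [div_pow]
              have := div_le_div_of_nonneg_right h1 (sq_nonneg θ)
              linarith
            have := mul_le_mul_of_nonneg_right h2 (h0 y)
            have : 0 ≤ C * (1 + ((y - x₀) / θ) ^ 2)⁻¹ := by positivity
            linarith
    _ = _ := by
        rw [integral_add (hk.const_mul C) (hf.const_mul _), integral_const_mul, integral_const_mul,
          hkint, integral_density hc h0, mul_one]

/-- The kernel averages are bounded in probability. -/
theorem measureReal_lt_cauchyAverage_le {Ω : Type*} [MeasurableSpace Ω] {P : Measure Ω}
    [IsProbabilityMeasure P] {X : ℕ → Ω → ℝ} (hXm : ∀ i, Measurable (X i))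
    (hlaw : ∀ i, P.map (X i) = densityMeasure f) (hc : Continuous f) (h0 : ∀ x, 0 ≤ f x)
    {x₀ δ C θ : ℝ} (hδ : 0 < δ) (hθ : 0 < θ) (hC0 : 0 ≤ C) (hC : ∀ y, |y - x₀| ≤ δ → f y ≤ C)
    {n : ℕ} (hn : 0 < n) {A : ℝ} (hA : 0 < A) :
    P.real {ω | A ≤ cauchyAverage x₀ θ (sample X n ω)} ≤ (C * Real.pi + θ / δ ^ 2) / A := by
  have hn' : (0 : ℝ) < n := Nat.cast_pos.2 hn
  set k : ℝ → ℝ := fun y => (1 + ((y - x₀) / θ) ^ 2)⁻¹ with hk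
  have hkm : Measurable k := by fun_prop
  have hk0 : ∀ y, 0 ≤ k y := fun y => by rw [hk]; positivity
  have hk1 : ∀ y, k y ≤ 1 := fun y => inv_le_one_of_one_le₀ (by nlinarith [sq_nonneg ((y - x₀) / θ)])
  have hint : ∀ i, Integrable (fun ω => k (X i ω)) P := fun i =>
    (integrable_const (1 : ℝ)).mono' (hkm.comp (hXm i)).aestronglyMeasurable
      (ae_of_all _ fun ω => by rw [Real.norm_eq_abs, abs_of_nonneg (hk0 _)]; exact hk1 _)
  have hsum : ∀ ω, cauchyAverage x₀ θ (sample X n ω) =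
      (∑ i ∈ Finset.range n, k (X i ω)) / (n * θ) := fun ω => by
    rw [Finset.sum_range]
    rfl
  simp_rw [hsum]
  have hmean : ∀ i, ∫ ω, k (X i ω) ∂P ≤ C * (θ * Real.pi) + θ ^ 2 / δ ^ 2 := fun i => by
    rw [← integral_map (hXm i).aemeasurable hkm.aestronglyMeasurable, hlaw]
    exact integral_cauchyKernel_le hc h0 hδ hθ hC0 hC
  have hI : Integrable (fun ω => (∑ i ∈ Finset.range n, k (X i ω)) / (n * θ)) P :=
    (integrable_finsetSum _ fun i _ => hint i).div_const _
  have hmarkov := mul_meas_ge_le_integral_of_nonneg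
    (ae_of_all P fun ω => div_nonneg (Finset.sum_nonneg fun i _ => hk0 (X i ω))
      (by positivity : (0 : ℝ) ≤ n * θ)) hI A
  rw [le_div_iff₀ hA, mul_comm]
  refine hmarkov.trans ?_
  rw [integral_div, integral_finsetSum _ fun i _ => hint i, div_le_iff₀ (by positivity)]
  refine (Finset.sum_le_sum fun i _ => hmean i).trans_eq ?_
  rw [Finset.sum_const, Finset.card_range, nsmul_eq_mul]
  field_simp

end Tails

/-! ### Deterministic accuracy of the spline through the root heights -/

section Stability

theorem abs_sqrt_sub_sqrt_le {a b r : ℝ} (ha : 0 ≤ a) (hb : 0 ≤ b) (h : |a - b| ≤ r) :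
    |√a - √b| ≤ √r := by
  refine Real.le_sqrt_of_sq_le (le_trans ?_ h)
  have h1 := Real.sqrt_nonneg a
  have h2 := Real.sqrt_nonneg b
  have h3 : a - b = (√a - √b) * (√a + √b) := by
    linear_combination (-1 : ℝ) * Real.sq_sqrt ha + Real.sq_sqrt hb
  have h4 : |√a - √b| ≤ √a + √b := by
    rw [abs_le]
    constructor <;> linarith
  rw [h3, abs_mul, abs_of_nonneg (add_nonneg h1 h2), sq]
  exact mul_le_mul_of_nonneg_left h4 (abs_nonneg _)

theorem exists_mem_Ioc_of_windowCount_pos {n : ℕ} {x : Fin n → ℝ} {u v : ℝ}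
    (h : 0 < windowCount x u v) : ∃ i, x i ∈ Ioc u v := by
  obtain ⟨i, _, hi⟩ := Finset.exists_ne_zero_of_sum_ne_zero h.ne'
  exact ⟨i, mem_of_indicator_ne_zero hi⟩

theorem abs_cast_sub_cast_le_dist (i j : ℕ) : |(j : ℝ) - i| ≤ Nat.dist i j := by
  have h1 : (j : ℝ) ≤ i + Nat.dist i j := by
    exact_mod_cast (by simp only [Nat.dist]; omega : j ≤ i + Nat.dist i j)
  have h2 : (i : ℝ) ≤ j + Nat.dist i j := by
    exact_mod_cast (by simp only [Nat.dist]; omega : i ≤ j + Nat.dist i j)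
  rw [abs_le]
  constructor <;> linarith

variable {n m : ℕ} {o θ x₀ c η ε A D : ℝ} {K : ℕ} {x : Fin n → ℝ} {z : Fin n × Fin m → ℝ}

/-- The height of a bin near `x₀` is close to `c` if all window counts near `x₀` are. -/
theorem abs_binHeight_sub_le (hm : 0 < m) (hθ : 0 < θ) (hη0 : 0 < η) (hη : η ≤ 1 / 2)
    (hz : ∀ p, |z p - x p.1| < η * θ) {W : ℝ}
    (hU : ∀ u v, -W ≤ u → u ≤ v → v ≤ W →
      |windowCount x (x₀ + u * θ) (x₀ + v * θ) / (n * θ) - c * (v - u)| ≤ ε)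
    {r : ℕ} {a : ℝ} (ha : o + ((firstBin o θ z + r : ℤ) : ℝ) * θ = x₀ + a * θ)
    (haW : -W ≤ a - η) (haW' : a + 1 + η ≤ W) :
    |binHeight o θ z r - c| ≤ 2 * η * c + ε := by
  have hbin : ∀ p, binIndex o θ (z p) = firstBin o θ z + r ↔
      x₀ + a * θ ≤ z p ∧ z p < x₀ + (a + 1) * θ := fun p => by
    rw [binIndex_eq_iff hθ, add_mul _ (1 : ℝ), ← add_assoc, ha]
    constructor <;> rintro ⟨h1, h2⟩ <;> constructor <;> linarith
  have hupper : binHeight o θ z r ≤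
      windowCount x (x₀ + (a - η) * θ) (x₀ + (a + 1 + η) * θ) / (n * θ) := by
    refine binHeight_le_sum hm hθ (fun i => indicator_nonneg (fun _ _ => zero_le_one) _)
      fun p hp => ?_
    have h1 := (hbin p).1 hp
    have h2 := abs_lt.1 (hz p)
    rw [indicator_of_mem]
    constructor <;> linarith
  have hlower : windowCount x (x₀ + (a + η) * θ) (x₀ + (a + 1 - η) * θ) / (n * θ) ≤
      binHeight o θ z r := by
    refine sum_le_binHeight hm hθ (fun i => indicator_apply_le' (fun _ => le_rfl)
      fun _ => zero_le_one) fun p hp => ?_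
    rw [indicator_of_notMem]
    intro hmem
    have h2 := abs_lt.1 (hz p)
    refine hp ((hbin p).2 ⟨?_, ?_⟩) <;> linarith [hmem.1, hmem.2]
  -- The enlarged and shrunken windows have lengths `1 + 2 * η` and `1 - 2 * η`, which produces the
  -- error `2 * η * c` besides `ε`.
  have u1 := abs_le.1 (hU (a - η) (a + 1 + η) haW (by linarith) haW')
  have u2 := abs_le.1 (hU (a + η) (a + 1 - η) (by linarith) (by linarith) (by linarith))
  rw [abs_le]
  constructor <;> nlinarith [u1.2, u2.1]

/-- The height of any bin is controlled by the kernel average and its distance from `x₀`. -/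
theorem binHeight_le_cauchyAverage (hm : 0 < m) (hθ : 0 < θ) (hη : η ≤ 1 / 2)
    (hz : ∀ p, |z p - x p.1| < η * θ) (hV : cauchyAverage x₀ θ x ≤ A)
    {r : ℕ} {a : ℝ} (ha : o + ((firstBin o θ z + r : ℤ) : ℝ) * θ = x₀ + a * θ) {d : ℝ} (hd : 0 ≤ d)
    (had : |a| ≤ d + 3 / 2) : binHeight o θ z r ≤ (d + 4) ^ 2 * A := by
  have had' := abs_le.1 had
  have hle : binHeight o θ z r ≤
      (∑ i, (d + 4) ^ 2 * (1 + ((x i - x₀) / θ) ^ 2)⁻¹) / (n * θ) := by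
    refine binHeight_le_sum hm hθ (fun i => by positivity) fun p hp => ?_
    rw [binIndex_eq_iff hθ, add_mul _ (1 : ℝ), ← add_assoc, ha] at hp
    have h2 := abs_lt.1 (hz p)
    have h3 : |(x p.1 - x₀) / θ| ≤ d + 3 := by
      rw [abs_div, abs_of_pos hθ, div_le_iff₀ hθ, abs_le]
      constructor <;> nlinarith
    have h4 : ((x p.1 - x₀) / θ) ^ 2 ≤ (d + 3) ^ 2 := by
      rw [← sq_abs]
      exact pow_le_pow_left₀ (abs_nonneg _) h3 2
    rw [← div_eq_mul_inv, le_div_iff₀ (by positivity), one_mul]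
    nlinarith
  refine hle.trans ?_
  rw [← Finset.mul_sum, mul_div_assoc]
  exact mul_le_mul_of_nonneg_left hV (sq_nonneg _)

/-- Deterministic accuracy of the spline through the root heights of the histogram. -/
theorem abs_naturalSpline_sqrt_binHeight_sub_le (hm : 0 < m) (hθ : 0 < θ) (hη0 : 0 < η)
    (hη : η ≤ 1 / 2) (hε0 : 0 ≤ ε) (hεc : ε < c) (hz : ∀ p, |z p - x p.1| < η * θ)
    (hU : ∀ u v, -(K + 3 : ℝ) ≤ u → u ≤ v → v ≤ K + 3 →
      |windowCount x (x₀ + u * θ) (x₀ + v * θ) / (n * θ) - c * (v - u)| ≤ ε)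
    (hV : cauchyAverage x₀ θ x ≤ A) (hD : √(2 * η * c + ε) ≤ D)
    (hDK : ∀ d : ℕ, K ≤ d → (2 / 3 : ℝ) ^ d * ((d + 4) * √A + √c) ≤ D) :
    |naturalSpline (firstMidpoint o θ z) θ (numBins o θ z) (fun r => √(binHeight o θ z r)) x₀ - √c|
      ≤ 15 * D := by
  have hc : 0 ≤ c := hε0.trans hεc.le
  -- Since `ε < c`, every window of length `θ` near `x₀` contains an observation.
  have hpos : ∀ u : ℝ, -(K + 3 : ℝ) ≤ u → u + 1 ≤ K + 3 →
      ∃ i, x i ∈ Ioc (x₀ + u * θ) (x₀ + (u + 1) * θ) := by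
    intro u h1 h2
    refine exists_mem_Ioc_of_windowCount_pos ?_
    by_contra hneg
    have h3 := (abs_le.1 (hU u (u + 1) h1 (by linarith) h2)).1
    have h4 : windowCount x (x₀ + u * θ) (x₀ + (u + 1) * θ) / (n * θ) ≤ 0 :=
      div_nonpos_of_nonpos_of_nonneg (not_lt.1 hneg) (by positivity)
    linarith
  have hK0 : (0 : ℝ) ≤ K := K.cast_nonneg
  have hηθ : η * θ ≤ θ / 2 := by nlinarith
  set b := firstMidpoint o θ z with hb
  set B := numBins o θ z with hB
  -- Observations in `(x₀ - 3θ, x₀ - 2θ]` and `(x₀ + 2θ, x₀ + 3θ]` place `x₀` at least `θ` inside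
  -- the range of midpoints, even after perturbation. This excludes the linear extrapolation and
  -- forces at least two bins.
  obtain ⟨i₁, hi₁⟩ := hpos (-3) (by linarith) (by linarith)
  obtain ⟨i₂, hi₂⟩ := hpos 2 (by linarith) (by linarith)
  have hbx : b ≤ x₀ - θ := by
    have h1 := firstMidpoint_le (o := o) hθ z (i₁, ⟨0, hm⟩)
    have h2 := abs_lt.1 (hz (i₁, ⟨0, hm⟩))
    linarith [hi₁.2, h2.2]
  have hxb : x₀ + θ ≤ b + (B - 1 : ℕ) * θ := by
    have h1 := le_lastMidpoint (o := o) hθ z (i₂, ⟨0, hm⟩)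
    have h2 := abs_lt.1 (hz (i₂, ⟨0, hm⟩))
    linarith [hi₂.1, h2.1]
  have hB2 : 2 ≤ B := by
    by_contra hlt
    have : B - 1 = 0 := by omega
    rw [this, Nat.cast_zero, zero_mul] at hxb
    linarith
  refine abs_naturalSpline_sub_le hθ hB2 (by linarith) (by linarith) fun j hj => ?_
  obtain ⟨hi1, hi2⟩ := splineIndex_bounds hθ hB2 (x := x₀) (b := b) (by linarith) (by linarith)
  set i := min ⌊(x₀ - b) / θ⌋₊ (B - 2)
  set d := Nat.dist i j with hd
  have hji := abs_le.1 (abs_cast_sub_cast_le_dist i j)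
  rw [← hd] at hji
  have hd0 : (0 : ℝ) ≤ d := d.cast_nonneg
  -- The lower edge of bin `j`, measured from `x₀` in bin widths. As `x₀` lies between midpoints `i`
  -- and `i + 1`, `a` is within `3 / 2` of `j - i`.
  set a : ℝ := (b - x₀) / θ + (j - 1 / 2) with ha
  have hξ1 : (b - x₀) / θ ≤ -i := by
    rw [div_le_iff₀ hθ]
    linarith
  have hξ2 : -(i + 1) ≤ (b - x₀) / θ := by
    rw [le_div_iff₀ hθ]
    linarith
  have hedge : o + ((firstBin o θ z + j : ℤ) : ℝ) * θ = x₀ + a * θ := by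
    rw [lowerEdge_eq, ← hb, ha]
    field_simp
    ring
  -- Near nodes have accurate heights, and the weight is bounded by one. At far nodes the weight
  -- beats the crude linear growth of the root height.
  rcases lt_or_ge d K with hdK | hdK
  · have hdK' : (d : ℝ) ≤ K := by exact_mod_cast hdK.le
    have h1 := abs_binHeight_sub_le hm hθ hη0 hη hz hU hedge (by linarith) (by linarith)
    have h2 := abs_sqrt_sub_sqrt_le (binHeight_nonneg hθ z j) hc h1
    calc dampingWeight i j * |√(binHeight o θ z j) - √c| ≤ 1 * D :=
          mul_le_mul (pow_le_one₀ (by norm_num) (by norm_num)) (h2.trans hD) (abs_nonneg _)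
            zero_le_one
      _ = D := one_mul D
  · have h1 := binHeight_le_cauchyAverage hm hθ hη hz hV hedge hd0
      (by rw [abs_le]; constructor <;> linarith)
    have h2 : √(binHeight o θ z j) ≤ (d + 4) * √A := by
      refine (Real.sqrt_le_sqrt h1).trans_eq ?_
      rw [Real.sqrt_mul (sq_nonneg _), Real.sqrt_sq (by linarith)]
    have h3 : |√(binHeight o θ z j) - √c| ≤ (d + 4) * √A + √c := by
      rw [abs_le]
      constructor <;> linarith [Real.sqrt_nonneg c, Real.sqrt_nonneg (binHeight o θ z j)]
    exact (mul_le_mul_of_nonneg_left h3 (dampingWeight_pos i j).le).trans (hDK d hdK)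

theorem exists_forall_pow_mul_le (A c : ℝ) {D : ℝ} (hD : 0 < D) :
    ∃ K : ℕ, ∀ d : ℕ, K ≤ d → (2 / 3 : ℝ) ^ d * ((d + 4) * √A + √c) ≤ D := by
  have h1 := tendsto_pow_const_mul_const_pow_of_abs_lt_one 1 (r := (2 / 3 : ℝ))
    (by rw [abs_of_pos] <;> norm_num)
  have h2 := tendsto_pow_const_mul_const_pow_of_abs_lt_one 0 (r := (2 / 3 : ℝ))
    (by rw [abs_of_pos] <;> norm_num)
  have h3 := (h1.mul_const (√A)).add (h2.mul_const (4 * √A + √c))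
  simp only [zero_mul, add_zero] at h3
  obtain ⟨K, hK⟩ := eventually_atTop.1 (h3.eventually (gt_mem_nhds hD))
  refine ⟨K, fun d hd => le_trans (le_of_eq ?_) (hK d hd).le⟩
  ring

end Stability

/-! ### Consistency under perturbations of smaller order than the bin width -/

section PseudoSample

theorem abs_pseudoSample_sub_le {n m k : ℕ} (hk : 1 ≤ k) {h : ℝ} (hh : 0 ≤ h) {u : ℕ → ℕ → ℕ → ℝ}
    (hu : ∀ i j l, |u i j l| ≤ 1 / 2) (x : Fin n → ℝ) (p : Fin n × Fin m) :
    |pseudoSample m k h u x p - x p.1| ≤ h := by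
  have hk' : (0 : ℝ) < k := Nat.cast_pos.2 hk
  rw [pseudoSample, add_sub_cancel_left, abs_mul, abs_of_nonneg (by positivity)]
  have h1 : |∑ l ∈ Finset.range k, u p.1 p.2 l| ≤ k * (1 / 2) := by
    refine (Finset.abs_sum_le_sum_abs _ _).trans
      ((Finset.sum_le_sum fun l _ => hu p.1 p.2 l).trans_eq ?_)
    rw [Finset.sum_const, Finset.card_range, nsmul_eq_mul]
  calc 2 * h / k * |∑ l ∈ Finset.range k, u p.1 p.2 l| ≤ 2 * h / k * (k * (1 / 2)) :=
        mul_le_mul_of_nonneg_left h1 (by positivity)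
    _ = h := by field_simp

variable {Ω : Type*} [MeasurableSpace Ω] {P : Measure Ω}

theorem ae_abs_le_of_isUniform [IsProbabilityMeasure P] {U : Ω → ℝ} (hU : Measurable U)
    (h : pdf.IsUniform U (Icc (-(1 / 2) : ℝ) (1 / 2)) P volume) : ∀ᵐ ω ∂P, |U ω| ≤ 1 / 2 := by
  have h1 : ∀ᵐ y ∂P.map U, y ∈ Icc (-(1 / 2) : ℝ) (1 / 2) := by
    rw [h, ProbabilityTheory.cond]
    exact Measure.ae_smul_measure (ae_restrict_mem measurableSet_Icc) _
  filter_upwards [ae_of_ae_map hU.aemeasurable h1] with ω hω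
  exact abs_le.2 hω

/-- Consistency of the histogram spline for perturbed observations, when the perturbations are of
smaller order than the bin width. -/
theorem tendstoInMeasure_shide {f : ℝ → ℝ} [IsProbabilityMeasure (densityMeasure f)]
    [IsProbabilityMeasure P] {X : ℕ → Ω → ℝ} (hXm : ∀ i, Measurable (X i)) (hX : iIndepFun X P)
    (hlaw : ∀ i, P.map (X i) = densityMeasure f) (hc : Continuous f) (h0 : ∀ x, 0 ≤ f x)
    {θ : ℕ → ℝ} (hθ : ∀ n, 0 < θ n) (hθ0 : Tendsto θ atTop (𝓝 0))
    (hnθ : Tendsto (fun n : ℕ => (n : ℝ) * θ n) atTop atTop) {m : ℕ → ℕ} (hm : ∀ n, 1 ≤ m n)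
    (o : ℕ → Ω → ℝ) (Z : ∀ n, Ω → Fin n × Fin (m n) → ℝ)
    (hZ : ∀ η, 0 < η → WithHighProbability P fun n ω =>
      ∀ p, |Z n ω p - sample X n ω p.1| < η * θ n)
    {x₀ : ℝ} (hx₀ : 0 < f x₀) :
    TendstoInMeasure P (fun n ω => shide (o n ω) (θ n) (Z n ω) x₀) atTop fun _ => f x₀ := by
  set c := f x₀ with hc'
  obtain ⟨δ, hδ, hloc⟩ := Metric.continuousAt_iff.1 (hc.continuousAt (x := x₀)) 1 one_pos
  have hC : ∀ y, |y - x₀| ≤ δ / 2 → f y ≤ c + 1 := by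
    intro y hy
    have := (abs_lt.1 (hloc (show dist y x₀ < δ by rw [Real.dist_eq]; linarith))).2
    linarith
  refine tendstoInMeasure_of_withHighProbability fun ε₀ hε₀ => ?_
  have hsq := Real.sqrt_nonneg c
  -- The spline error `15 * D` must be at most `15`, to bound the second factor of `s ^ 2 - c = (s -
  -- √c) * (s + √c)`, and small enough that the product is at most `ε₀ / 2`.
  set D := min 1 (ε₀ / (30 * (15 + 2 * √c))) with hD
  have hD0 : 0 < D := lt_min one_pos (by positivity)
  set ε := min (c / 2) (D ^ 2 / 2) with hε
  have hεpos : 0 < ε := lt_min (by linarith) (by positivity)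
  set η := min (1 / 2) (D ^ 2 / (4 * c)) with hη
  have hηpos : 0 < η := lt_min (by norm_num) (by positivity)
  have hsqrt : √(2 * η * c + ε) ≤ D := by
    rw [Real.sqrt_le_left hD0.le]
    have h1 : η * c ≤ D ^ 2 / 4 := by
      calc η * c ≤ D ^ 2 / (4 * c) * c := mul_le_mul_of_nonneg_right (min_le_right _ _) hx₀.le
        _ = D ^ 2 / 4 := by field_simp
    have h2 : ε ≤ D ^ 2 / 2 := min_le_right _ _
    linarith
  -- The kernel average is bounded in probability, not by a fixed constant with probability tending
  -- to one. So the failure level `ρ` comes first; then `A` has failure probability at most `ρ' /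
  -- 2`, `K` is chosen from `A`, and the windows cover `K + 3` bins on each side.
  refine ENNReal.tendsto_nhds_zero.2 fun ρ hρ => ?_
  obtain ⟨ρ', hρ'0, hρ'⟩ : ∃ ρ' : ℝ, 0 < ρ' ∧ ENNReal.ofReal ρ' ≤ ρ := by
    obtain ⟨q, hq, hqρ⟩ := ENNReal.lt_iff_exists_real_btwn.1 hρ
    exact ⟨q, ENNReal.ofReal_pos.1 hqρ.1, hqρ.2.le⟩
  set C' := (c + 1) * Real.pi + 1 / (δ / 2) ^ 2 with hC'
  have hC'0 : 0 < C' := by positivity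
  set A := C' / (ρ' / 2) with hA
  have hA0 : 0 < A := by positivity
  obtain ⟨K, hK⟩ := exists_forall_pow_mul_le A c hD0
  have hgood := (withHighProbability_forall_windowCount hXm hX hlaw hc h0 hθ hθ0 hnθ x₀ (K + 3)
    hεpos).and (hZ η hηpos)
  have hgood' := ENNReal.tendsto_nhds_zero.1 hgood (ENNReal.ofReal (ρ' / 2))
    (ENNReal.ofReal_pos.2 (half_pos hρ'0))
  filter_upwards [hgood', hθ0.eventually (gt_mem_nhds one_pos), eventually_gt_atTop 0]
    with n hn hθ1 hn0
  have hV : P {ω | A ≤ cauchyAverage x₀ (θ n) (sample X n ω)} ≤ ENNReal.ofReal (ρ' / 2) := by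
    rw [← ofReal_measureReal (measure_ne_top _ _)]
    refine ENNReal.ofReal_le_ofReal ((measureReal_lt_cauchyAverage_le hXm hlaw hc h0
      (half_pos hδ) (hθ n) (by linarith) hC hn0 hA0).trans ?_)
    have h1 : (c + 1) * Real.pi + θ n / (δ / 2) ^ 2 ≤ C' := by
      have := div_le_div_of_nonneg_right hθ1.le (sq_nonneg (δ / 2))
      linarith
    rw [div_le_iff₀ hA0, hA]
    refine h1.trans_eq ?_
    field_simp
  refine (measure_mono ?_).trans ((measure_union_le _ _).trans
    ((add_le_add hn hV).trans ?_))
  · intro ω hω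
    by_contra hcon
    simp only [mem_union, mem_ofPred_eq, not_or, not_not, not_le] at hcon
    obtain ⟨⟨hU, hz⟩, hVω⟩ := hcon
    refine hω ?_
    have key := abs_naturalSpline_sqrt_binHeight_sub_le (o := o n ω) (hm n) (hθ n) hηpos
      (min_le_left _ _) hεpos.le
      ((min_le_left _ _).trans_lt (half_lt_self hx₀)) hz hU hVω.le hsqrt hK
    rw [shide]
    set s := naturalSpline (firstMidpoint (o n ω) (θ n) (Z n ω)) (θ n)
      (numBins (o n ω) (θ n) (Z n ω)) (fun r => √(binHeight (o n ω) (θ n) (Z n ω) r)) x₀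
    have h1 : s ^ 2 - c = (s - √c) * (s - √c + 2 * √c) := by
      linear_combination Real.sq_sqrt hx₀.le
    have hD1 : D ≤ 1 := min_le_left _ _
    have h2 : |s - √c + 2 * √c| ≤ 15 + 2 * √c := by
      refine (abs_add_le _ _).trans ?_
      rw [abs_of_nonneg (by positivity : 0 ≤ 2 * √c)]
      linarith
    have h3 : D ≤ ε₀ / (30 * (15 + 2 * √c)) := min_le_right _ _
    rw [h1, abs_mul]
    calc |s - √c| * |s - √c + 2 * √c| ≤ 15 * (ε₀ / (30 * (15 + 2 * √c))) * (15 + 2 * √c) :=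
          mul_le_mul (key.trans (by linarith)) h2 (abs_nonneg _) (by positivity)
      _ = ε₀ / 2 := by field_simp; norm_num
      _ < ε₀ := half_lt_self hε₀
  · rw [← ENNReal.ofReal_add (by positivity) (by positivity), add_halves]
    exact hρ'

end PseudoSample

/-! ### Values of the density on intervals and the location of the quantile spacing -/

section Location

theorem betweenInfSup_of_mem {f : ℝ → ℝ} (hc : Continuous f) {I : Set ℝ}
    (hI : Bornology.IsBounded I) {x : ℝ} (hx : x ∈ I) : BetweenInfSup f I (f x) :=
  have hcpt : IsCompact (f '' closure I) := hI.isCompact_closure.image hc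
  have hsub : f '' I ⊆ f '' closure I := image_mono subset_closure
  ⟨csInf_le (hcpt.bddBelow.mono hsub) (mem_image_of_mem f hx),
    le_csSup (hcpt.bddAbove.mono hsub) (mem_image_of_mem f hx)⟩

theorem isCompact_spacingLocation {n : ℕ} (α : ℝ) (x : Fin n → ℝ) :
    IsCompact (spacingLocation α x) :=
  (toFinite _).isCompact_biUnion fun _ _ => isCompact_Icc

theorem spacingLocation_subset {n : ℕ} {α : ℝ} {x : Fin n → ℝ} {T : Set ℝ} (hT : T.OrdConnected)
    (hx : ∀ i, x i ∈ T) : spacingLocation α x ⊆ T :=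
  iUnion₂_subset fun _ _ => hT.out (hx _) (hx _)

end Location

/-! ### Assembly of the theorem -/

theorem mainTheorem8 {Ω : Type*} [MeasurableSpace Ω] (P : Measure Ω) [IsProbabilityMeasure P]
    (S : Set ℝ) (f : ℝ → ℝ) (hf : RegularDensity f S)
    (X : ℕ → Ω → ℝ) (hXmeas : ∀ i, Measurable (X i)) (hXindep : iIndepFun X P)
    (hXlaw : ∀ i, P.map (X i) = volume.withDensity (fun x => ENNReal.ofReal (f x)))
    (α : ℝ) (hα : α ∈ Ioo (0 : ℝ) 1) :
    -- the expansion of the spacing quantile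
    (∃ a b : ℝ, a < b ∧ Icc a b ⊆ interior S ∧
      ∃ fbar R : ℕ → Ω → ℝ,
        (∀ n, Measurable (fbar n)) ∧
        (∀ n : ℕ, 2 ≤ n → ∀ ω, spacingQuantile α (sample X n ω) =
          (-Real.log (1 - α)) / ((n : ℝ) * fbar n ω) * (1 + R n ω)) ∧
        TendstoInMeasure P R atTop (fun _ => 0) ∧
        Tendsto (fun n => P {ω | ¬ BetweenInfSup f (Icc a b) (fbar n ω)}) atTop (𝓝 0) ∧
        -- if `S` is an interval, the interior interval may be taken around the `α`-spacing
        (S.OrdConnected → Tendsto (fun n => P {ω |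
          ¬ (convexHull ℝ (Icc a b ∪ spacingLocation α (sample X n ω)) ⊆ interior S ∧
            BetweenInfSup f (convexHull ℝ (Icc a b ∪ spacingLocation α (sample X n ω)))
              (fbar n ω))}) atTop (𝓝 0))) ∧
    -- the raw bandwidth tends to zero
    TendstoInMeasure P (fun n ω => rawBandwidth α (sample X n ω)) atTop (fun _ => 0) ∧
    -- it is exactly of order `1 / n`
    (∃ c C : ℝ, 0 < c ∧ c ≤ C ∧ Tendsto (fun n : ℕ => P {ω |
      ¬ (c / n ≤ rawBandwidth α (sample X n ω) ∧ rawBandwidth α (sample X n ω) ≤ C / n)})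
        atTop (𝓝 0)) ∧
    -- it undersmooths relative to the rate `n ^ (-1/5)`
    TendstoInMeasure P
      (fun (n : ℕ) ω => rawBandwidth α (sample X n ω) / (n : ℝ) ^ (-(1 / 5) : ℝ))
      atTop (fun _ => 0) ∧
    -- SHIDE with the raw bandwidth is pointwise consistent
    (∀ k : ℕ, 1 ≤ k → ∀ U : ℕ → ℕ → ℕ → Ω → ℝ,
      (∀ i j l, Measurable (U i j l)) →
      (∀ i j l, pdf.IsUniform (U i j l) (Icc (-(1 / 2) : ℝ) (1 / 2)) P volume) →
      iIndepFun (Sum.elim X (fun p : ℕ × ℕ × ℕ => U p.1 p.2.1 p.2.2)) P →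
      ∀ (m : ℕ → ℕ) (θ : ℕ → ℝ) (o : ℕ → Ω → ℝ),
        (∀ n, 1 ≤ m n) → (∀ n, 0 < θ n) →
        Tendsto θ atTop (𝓝 0) → Tendsto (fun n : ℕ => (n : ℝ) * θ n) atTop atTop →
        ∀ x ∈ interior S,
          TendstoInMeasure P
            (fun n ω => shide (o n ω) (θ n)
              (pseudoSample (m n) k (rawBandwidth α (sample X n ω)) (fun i j l => U i j l ω)
                (sample X n ω)) x)
            atTop (fun _ => f x)) := by
  have hc : Continuous f := hf.contDiff.continuous
  have h0 := hf.nonneg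
  have hlaw : ∀ i, P.map (X i) = densityMeasure f := hXlaw
  have hprob : IsProbabilityMeasure (densityMeasure f) :=
    hlaw 0 ▸ Measure.isProbabilityMeasure_map (hXmeas 0).aemeasurable
  obtain ⟨τ, hτ, hGτ⟩ := exists_spacingSurvival_eq hc h0 (p := 1 - α)
    ⟨by linarith [hα.2], by linarith [hα.1]⟩
  have hquant := fun ε (hε : (0 : ℝ) < ε) =>
    withHighProbability_abs_mul_spacingQuantile_sub hXmeas hXindep hlaw hc h0 hα hτ hGτ hε
  -- Accuracy `τ` gives `0 < n * d_α < 2 * τ`; halving yields the bound `τ / n` for the bandwidth.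
  have hband : WithHighProbability P fun n ω => 0 ≤ rawBandwidth α (sample X n ω) ∧
      rawBandwidth α (sample X n ω) ≤ τ / n := by
    refine (hquant τ hτ).mono ?_
    filter_upwards [eventually_gt_atTop 0] with n hn ω hω
    have hn' : (0 : ℝ) < n := Nat.cast_pos.2 hn
    have h1 := abs_lt.1 hω
    rw [rawBandwidth]
    constructor
    · have : 0 < n * spacingQuantile α (sample X n ω) := by linarith
      linarith [pos_of_mul_pos_right this hn'.le]
    · rw [le_div_iff₀ hn']
      linarith
  refine ⟨?_, ?_, ?_, ?_, ?_⟩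
  · set q := -Real.log (1 - α) with hq
    have hq0 : 0 < q := neg_pos.2 (Real.log_neg (by linarith [hα.2]) (by linarith [hα.1]))
    have hv : 0 < q / τ := div_pos hq0 hτ
    obtain ⟨x, hx⟩ := exists_eq_of_exp_eq_spacingSurvival hc h0 hτ (v := q / τ) (by
      rw [hGτ, mul_div_cancel₀ _ hτ.ne', hq, neg_neg, Real.exp_log (by linarith [hα.2])])
    have hxS : x ∈ interior S := (hf.pos_iff x).1 (hx ▸ hv)
    obtain ⟨r, hr, hball⟩ := Metric.nhds_basis_closedBall.mem_iff.1 (isOpen_interior.mem_nhds hxS)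
    rw [Real.closedBall_eq_Icc] at hball
    have hxI : x ∈ Icc (x - r) (x + r) := ⟨by linarith, by linarith⟩
    -- With `f̄ = q / τ` constant, the remainder is defined so that the expansion is an identity for
    -- `n ≥ 2`; its convergence to zero is that of `n * d_α / τ` to one.
    refine ⟨x - r, x + r, by linarith, hball, fun _ _ => q / τ,
      fun n ω => n * spacingQuantile α (sample X n ω) / τ - 1, fun _ => measurable_const, ?_, ?_, ?_,
      fun hS => ?_⟩
    · intro n hn ω
      have hn' : (n : ℝ) ≠ 0 := Nat.cast_ne_zero.2 (by omega)
      field_simp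
      ring
    · refine tendstoInMeasure_of_withHighProbability fun ε hε => ?_
      refine (hquant (ε * τ) (mul_pos hε hτ)).mono (Eventually.of_forall fun n ω hω => ?_)
      have : n * spacingQuantile α (sample X n ω) / τ - 1 - 0 =
          (n * spacingQuantile α (sample X n ω) - τ) / τ := by field_simp; ring
      rw [this, abs_div, abs_of_pos hτ, div_lt_iff₀ hτ]
      exact hω
    · exact WithHighProbability.of_ae fun n => ae_of_all _ fun ω =>
        hx ▸ betweenInfSup_of_mem hc (Metric.isBounded_Icc _ _) hxI
    -- Almost surely all observations lie in the interior of `S`, which is convex when `S` is an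
    -- interval, so the hull stays inside it. The hull contains `x`, where `f` takes the value `f̄`.
    · have hmem : ∀ᵐ ω ∂P, ∀ i, X i ω ∈ interior S := ae_all_iff.2 fun i => by
        have h1 : ∀ᵐ y ∂P.map (X i), y ∈ interior S := by
          rw [hlaw i]
          exact (ae_densityMeasure_pos hc).mono fun y hy => (hf.pos_iff y).1 hy
        exact ae_of_ae_map (hXmeas i).aemeasurable h1
      refine WithHighProbability.of_ae fun n => hmem.mono fun ω hω => ⟨?_, ?_⟩
      · exact convexHull_min (union_subset hball (spacingLocation_subset hS.interior fun i => hω i))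
          hS.interior.convex
      · exact hx ▸ betweenInfSup_of_mem hc
          (isBounded_convexHull.2 (isCompact_Icc.union (isCompact_spacingLocation α _)).isBounded)
          (subset_convexHull ℝ _ (Or.inl hxI))
  · refine tendstoInMeasure_of_withHighProbability fun ε hε => hband.mono ?_
    filter_upwards [(tendsto_const_div_atTop_nhds_zero_nat τ).eventually (gt_mem_nhds hε)]
      with n hn ω hω
    rw [sub_zero, abs_of_nonneg hω.1]
    exact hω.2.trans_lt hn
  -- Accuracy `τ / 2` gives `n * d_α > τ / 2`, and half of it is `τ / 4`.
  · refine ⟨τ / 4, τ, by positivity, by linarith, ?_⟩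
    refine (hband.and (hquant (τ / 2) (half_pos hτ))).mono ?_
    filter_upwards [eventually_gt_atTop 0] with n hn ω hω
    have hn' : (0 : ℝ) < n := Nat.cast_pos.2 hn
    refine ⟨?_, hω.1.2⟩
    have h1 := abs_lt.1 hω.2
    rw [rawBandwidth, div_le_iff₀ hn']
    linarith
  · refine tendstoInMeasure_of_withHighProbability fun ε hε => hband.mono ?_
    have hlim : Tendsto (fun n : ℕ => τ * (n : ℝ) ^ (-(4 / 5) : ℝ)) atTop (𝓝 0) := by
      simpa using ((tendsto_rpow_neg_atTop (by norm_num : (0 : ℝ) < 4 / 5)).comp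
        (tendsto_natCast_atTop_atTop (R := ℝ))).const_mul τ
    filter_upwards [hlim.eventually (gt_mem_nhds hε), eventually_gt_atTop 0] with n hn hn0 ω hω
    have hn' : (0 : ℝ) < n := Nat.cast_pos.2 hn0
    have hpow : 0 < (n : ℝ) ^ (-(1 / 5) : ℝ) := Real.rpow_pos_of_pos hn' _
    rw [sub_zero, abs_of_nonneg (div_nonneg hω.1 hpow.le), div_lt_iff₀ hpow]
    refine hω.2.trans_lt ?_
    have h1 : (n : ℝ) ^ (-(4 / 5) : ℝ) * (n : ℝ) ^ (-(1 / 5) : ℝ) = (n : ℝ)⁻¹ := by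
      rw [← Real.rpow_add hn', ← Real.rpow_neg_one]
      norm_num
    rw [div_eq_mul_inv, ← h1, ← mul_assoc]
    exact mul_lt_mul_of_pos_right hn hpow
  · intro k hk U hUmeas hUunif _ m θ o hm hθ hθ0 hnθ x hx
    have hU : ∀ᵐ ω ∂P, ∀ i j l, |U i j l ω| ≤ 1 / 2 :=
      ae_all_iff.2 fun i => ae_all_iff.2 fun j => ae_all_iff.2 fun l =>
        ae_abs_le_of_isUniform (hUmeas i j l) (hUunif i j l)
    refine tendstoInMeasure_shide hXmeas hXindep hlaw hc h0 hθ hθ0 hnθ hm o _ (fun η hη => ?_)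
      ((hf.pos_iff x).2 hx)
    refine (hband.and (.of_ae fun _ => hU)).mono ?_
    -- Once `n * θ n > τ / η`, the largest possible perturbation `τ / n` is below `η * θ n`.
    filter_upwards [hnθ.eventually_gt_atTop (τ / η), eventually_gt_atTop 0] with n hn hn0 ω hω p
    have hn' : (0 : ℝ) < n := Nat.cast_pos.2 hn0
    refine (abs_pseudoSample_sub_le hk hω.1.1 hω.2 _ p).trans_lt (hω.1.2.trans_lt ?_)
    rw [div_lt_iff₀ hη] at hn
    rw [div_lt_iff₀ hn']
    linarith
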